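/- Card-cyclic to random insertion shuffle: start with a deck of $n$ cards numbered $1,\dots,n$ in increasing order from left to right; for $c=1,\dots,n$ in turn, remove card $c$ and reinsert it so that it is in a position chosen uniformly from $\{1,\dots,n\}$, the choices being independent. Let $p_n$ be the resulting law on permutations $\sigma\in S_n$, where $\sigma_i$ is the card in position $i$, so that $\sigma^{-1}_j$ is the final position of card $j$. For every $b\in[0,1]$ there are a probability density $f_b$ and a number $E(b)$ such that, for all integers $1\le j_n\le n$ with $j_n/n\to b$, $$\lim_{n\to\infty}p_n(\sigma^{-1}_{j_n}\le xn)=\int_{-\infty}^x f_b(t)\,dt\quad(0\le x\le 1),\qquad \lim_{n\to\infty}\tfrac1n\,E^{p_n}\sigma^{-1}_{j_n}=E(b).$$ For $b_1,b_2\in[0,1]$ let $(\Sigma_{1;b_1},\Sigma_{2;b_2})$ be a random vector with density $f_{b_1}(x_1)f_{b_2}(x_2)$. (i) The equation $(1-b)e^b-\frac12=0$ has exactly one root $\hat b$ in $[0,1]$; it lies in $(0,1)$ and $|\hat b-0.768|<0.0005$. For every $b_1\in[0,\hat b)$ there is $\varepsilon>0$ such that $P(\Sigma_{1;b_1}<\Sigma_{2;b_2})>\frac12$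 whenever $b_1<b_2<\hat b$ and $b_2<b_1+\varepsilon$. For every $b_1\in(\hat b,1)$ there is $\varepsilon>0$ such that $P(\Sigma_{1;b_1}<\Sigma_{2;b_2})<\frac12$ whenever $b_1<b_2\le 1$ and $b_2<b_1+\varepsilon$. (ii) The equation $E(b)=\frac12$ has exactly one root $\tilde b$ in $[0,1)$; it lies in $(0,1)$ and $|\tilde b-0.380|<0.0005$. For $b\in[0,1)$, $P(\Sigma_{1;b}<\Sigma_{2;1})>\frac12$ if and only if $b<\tilde b$, and $P(\Sigma_{1;b}<\Sigma_{2;1})<\frac12$ if and only if $b>\tilde b$. -/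

import Mathlib

open Real Set Filter Topology MeasureTheory
open scoped ENNReal

noncomputable section

/-- A deck of `n + 1` cards is a permutation `σ` of `Fin (n + 1)`: `σ i` is the card in position `i`.
Positions and cards are both indexed from `0` to `n`, so index `i` stands for the number `i + 1`.

`moveCard σ c k` is the deck obtained from `σ` by removing card `c` and reinserting it so that it
is in position `k`; the other cards keep their relative order. -/
def moveCard {n : ℕ} (σ : Equiv.Perm (Fin (n + 1))) (c k : Fin (n + 1)) :
    Equiv.Perm (Fin (n + 1)) :=
  (finSuccEquiv' k).trans ((finSuccEquiv' (σ.symm c)).symm.trans σ)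

theorem moveCard_self {n : ℕ} (σ : Equiv.Perm (Fin (n + 1))) (c k : Fin (n + 1)) :
    moveCard σ c k k = c := by
  simp [moveCard]

theorem moveCard_succAbove {n : ℕ} (σ : Equiv.Perm (Fin (n + 1))) (c k : Fin (n + 1)) (i : Fin n) :
    moveCard σ c k (k.succAbove i) = σ ((σ.symm c).succAbove i) := by
  simp [moveCard]

/-- The final deck when, starting from the identity, each card `0, 1, …, n` is removed in turn
and reinserted, card `c` being reinserted in position `ω c`. -/
def cyclicInsertion (n : ℕ) (ω : Fin (n + 1) → Fin (n + 1)) : Equiv.Perm (Fin (n + 1)) :=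
  (List.finRange (n + 1)).foldl (fun σ c => moveCard σ c (ω c)) 1

/-- The law on permutations of one card-cyclic to random insertion shuffle of `n + 1` cards, started
from the identity: the reinsertion positions are independent and uniform. -/
def shuffleLaw (n : ℕ) : PMF (Equiv.Perm (Fin (n + 1))) :=
  (PMF.uniformOfFintype (Fin (n + 1) → Fin (n + 1))).map (cyclicInsertion n)

/-- The position, counted from `1`, of card `j` in the deck `σ`. -/
def cardPosition {n : ℕ} (σ : Equiv.Perm (Fin (n + 1))) (j : Fin (n + 1)) : ℝ :=
  ((σ.symm j : ℕ) : ℝ) + 1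

/-- The probability that card `j` ends up in a position at most `x (n + 1)`. -/
def positionCDF (n : ℕ) (j : Fin (n + 1)) (x : ℝ) : ℝ :=
  ((shuffleLaw n).toOuterMeasure {σ | cardPosition σ j ≤ x * ((n : ℝ) + 1)}).toReal

/-- The expected final position of card `j`. -/
def meanPosition (n : ℕ) (j : Fin (n + 1)) : ℝ :=
  ∑ σ : Equiv.Perm (Fin (n + 1)), (shuffleLaw n σ).toReal * cardPosition σ j

/-- `j n` is a card of the deck of `n + 1` cards, for each `n`, whose number (counted from `1`)
is asymptotic to the fraction `b` of the deck. -/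
def IsCardSequence (b : ℝ) (j : (n : ℕ) → Fin (n + 1)) : Prop :=
  Tendsto (fun n : ℕ => (((j n : ℕ) : ℝ) + 1) / ((n : ℝ) + 1)) atTop (𝓝 b)

/-- `f` is the density of the limiting rescaled final position of a card with a number around
`b` times the size of the deck. -/
structure IsLimitDensity (b : ℝ) (f : ℝ → ℝ≥0∞) : Prop where
  measurable : Measurable f
  lintegral_eq_one : ∫⁻ x, f x = 1
  tendsto_cdf : ∀ j : (n : ℕ) → Fin (n + 1), IsCardSequence b j → ∀ x ∈ Icc (0 : ℝ) 1,
    Tendsto (fun n : ℕ => positionCDF n (j n) x) atTop (𝓝 (∫⁻ t in Iic x, f t).toReal)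

/-- `m` is the limiting rescaled expected final position of a card with a number around
`b` times the size of the deck. -/
def IsLimitMean (b m : ℝ) : Prop :=
  ∀ j : (n : ℕ) → Fin (n + 1), IsCardSequence b j →
    Tendsto (fun n : ℕ => meanPosition n (j n) / ((n : ℝ) + 1)) atTop (𝓝 m)

/-- The probability that `X₁ < X₂` when the random vector `(X₁, X₂)` has the density
`f (x₁) * g (x₂)` on the plane. -/
def probLeft (f g : ℝ → ℝ≥0∞) : ℝ :=
  (((volume : Measure (ℝ × ℝ)).withDensity (fun z => f z.1 * g z.2)) {z | z.1 < z.2}).toReal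

end

open scoped BigOperators

/-! Write N = n + 1 and g = 1 + 1/N. Untouched cards stay in increasing order, so the card about to
be moved lies to the left of every other untouched card. Hence, while a card is untouched, its N
minus position grows in conditional mean by the factor g per step. After card j is reinserted the
same law holds as long as untouched cards remain to its left, up to `clearTime`; afterwards every
removal takes place to its right and it is position + 1 that grows by g. Rescaled by powers of g,
these quantities are martingales with increments at most 3, so they fluctuate by O(√N) in mean.

Consequently the final position of a card near bN, divided by N, is close in L¹ to L_b(U), with U
the rescaled reinsertion position, asymptotically uniform, and L_b = `limitPosition b`. The map L_b
increases strictly from 0 to 1, so the limit law is the image of the uniform law under L_b, and any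
admissible density or mean is forced to agree with it (`IsLimitDensity.withDensity_eq`,
`IsLimitMean.eq_integral`).

For (i), L_b is exp(min(w, 1 - b)) - e w with w = (1 - u) exp(-b). Solving L_{b₁}(φ(v)) = L_{b₂}(v)
gives φ(v) = d v for small v and d v + 1 - d for large v, with d = exp(b₁ - b₂). Moving the jump to
c = `frontPosition b₂` bounds φ from below, and to c = `frontPosition b₁` from above; the integral
is then 1/2 + (1 - d)(1/2 - c). The sign of 1/2 - c is that of (1 - b) exp b - 1/2 at the
corresponding b.

For (ii), L_1 is the identity, so the probability is 1 - E(b), where E(b) = exp(1 - b)/2 + e b - exp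
b. This starts below 1/2, rises, then falls to 1/2 at b = 1, hence crosses 1/2 once on [0,1). -/

/-! ### Motion of a card during the shuffle -/

theorem moveCard_symm_self {n : ℕ} (σ : Equiv.Perm (Fin (n + 1))) (c k : Fin (n + 1)) :
    (moveCard σ c k).symm c = k := by
  rw [Equiv.symm_apply_eq, moveCard_self]

theorem val_succAbove {n : ℕ} (k : Fin (n + 1)) (i : Fin n) :
    (k.succAbove i : ℕ) = if (i : ℕ) < k then (i : ℕ) else i + 1 := by
  unfold Fin.succAbove
  simp only [Fin.lt_def, Fin.val_castSucc]
  split_ifs <;> simp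

/-- Where a card other than the moved card `c` goes: first the removal of `c`, then its
reinsertion in position `k`. -/
theorem moveCard_symm_of_ne {n : ℕ} (σ : Equiv.Perm (Fin (n + 1))) {c k i : Fin (n + 1)}
    (h : i ≠ c) :
    ((moveCard σ c k).symm i : ℕ) =
      if (σ.symm c : ℕ) < σ.symm i then
        (if (k : ℕ) < σ.symm i then (σ.symm i : ℕ) else (σ.symm i : ℕ) - 1)
      else (if (k : ℕ) ≤ σ.symm i then (σ.symm i : ℕ) + 1 else (σ.symm i : ℕ)) := by
  have hne : σ.symm i ≠ σ.symm c := fun e => h (σ.symm.injective e)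
  obtain ⟨p, hp⟩ := Fin.exists_succAbove_eq hne
  have hi : (moveCard σ c k).symm i = k.succAbove p := by
    rw [Equiv.symm_apply_eq, moveCard_succAbove, hp, Equiv.apply_symm_apply]
  rw [hi, ← hp, val_succAbove, val_succAbove]
  split_ifs <;> omega

theorem moveCard_symm_lt_iff {n : ℕ} (σ : Equiv.Perm (Fin (n + 1))) {c k i i' : Fin (n + 1)}
    (h : i ≠ c) (h' : i' ≠ c) :
    (moveCard σ c k).symm i < (moveCard σ c k).symm i' ↔ σ.symm i < σ.symm i' := by
  have hne : (σ.symm i : ℕ) ≠ σ.symm c := fun e => h (σ.symm.injective (Fin.ext e))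
  have hne' : (σ.symm i' : ℕ) ≠ σ.symm c := fun e => h' (σ.symm.injective (Fin.ext e))
  rw [Fin.lt_def, Fin.lt_def, moveCard_symm_of_ne σ h, moveCard_symm_of_ne σ h']
  split_ifs <;> omega

/-- The deck after the first `s` cards have been reinserted. -/
def deck {n : ℕ} (ω : Fin (n + 1) → Fin (n + 1)) : ℕ → Equiv.Perm (Fin (n + 1))
  | 0 => 1
  | s + 1 => if h : s < n + 1 then moveCard (deck ω s) ⟨s, h⟩ (ω ⟨s, h⟩) else deck ω s

theorem deck_succ {n : ℕ} (ω : Fin (n + 1) → Fin (n + 1)) (c : Fin (n + 1)) :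
    deck ω (c + 1) = moveCard (deck ω c) c (ω c) := by
  simp [deck, Fin.is_le]

theorem foldl_take_finRange {n : ℕ} (ω : Fin (n + 1) → Fin (n + 1)) (s : ℕ) (hs : s ≤ n + 1) :
    ((List.finRange (n + 1)).take s).foldl (fun σ c => moveCard σ c (ω c)) 1 = deck ω s := by
  induction s with
  | zero => simp [deck]
  | succ s ih =>
    have hs' : s < n + 1 := hs
    rw [List.take_succ_eq_append_getElem (by simpa using hs'), List.foldl_append, ih (by omega)]
    simp [deck, hs']

theorem cyclicInsertion_eq_deck {n : ℕ} (ω : Fin (n + 1) → Fin (n + 1)) :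
    cyclicInsertion n ω = deck ω (n + 1) := by
  rw [← foldl_take_finRange ω _ le_rfl, cyclicInsertion, List.take_of_length_le (by simp)]

theorem deck_update {n : ℕ} (ω : Fin (n + 1) → Fin (n + 1)) (c k : Fin (n + 1)) {s : ℕ}
    (hs : s ≤ c) : deck (Function.update ω c k) s = deck ω s := by
  induction s with
  | zero => rfl
  | succ s ih =>
    have hs' : s < n + 1 := by omega
    have hne : (⟨s, hs'⟩ : Fin (n + 1)) ≠ c := by
      rintro rfl; simp at hs
    simp [deck, hs', ih (by omega), Function.update_of_ne hne]

/-- Cards not touched between times `s` and `t` keep their relative order. -/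
theorem deck_symm_lt_iff {n : ℕ} (ω : Fin (n + 1) → Fin (n + 1)) {s t : ℕ} (hst : s ≤ t)
    {i i' : Fin (n + 1)} (h : (i : ℕ) < s ∨ t ≤ i) (h' : (i' : ℕ) < s ∨ t ≤ i') :
    (deck ω t).symm i < (deck ω t).symm i' ↔ (deck ω s).symm i < (deck ω s).symm i' := by
  induction t, hst using Nat.le_induction with
  | base => rfl
  | succ t ht ih =>
    rw [← ih (by omega) (by omega)]
    by_cases hl : t < n + 1
    · have e := deck_succ ω ⟨t, hl⟩
      simp only at e
      rw [e, moveCard_symm_lt_iff]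
      · rintro rfl; simp at h; omega
      · rintro rfl; simp at h'; omega
    · simp [deck, hl]

/-- The cards not yet touched are in increasing order. -/
theorem deck_symm_strictMono {n : ℕ} (ω : Fin (n + 1) → Fin (n + 1)) {s : ℕ}
    {i i' : Fin (n + 1)} (h : s ≤ i) (h' : i < i') :
    (deck ω s).symm i < (deck ω s).symm i' := by
  rw [deck_symm_lt_iff ω (Nat.zero_le s) (Or.inr h) (Or.inr (h.trans h'.le))]
  exact h'

/-- Positions of successive untouched cards increase by at least one. This turns control of one
untouched card into control of `clearTime`. -/
theorem deck_symm_expand {n : ℕ} (ω : Fin (n + 1) → Fin (n + 1)) {s : ℕ}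
    {i i' : Fin (n + 1)} (h : s ≤ i) (h' : i ≤ i') :
    ((deck ω s).symm i : ℕ) + (i' - i : ℕ) ≤ (deck ω s).symm i' := by
  obtain ⟨d, hd⟩ : ∃ d, (i' : ℕ) = i + d := Nat.exists_eq_add_of_le h'
  induction d generalizing i' with
  | zero => 
    have : i' = i := Fin.ext hd
    simp [this]
  | succ d ih =>
    have h1 := ih (i' := ⟨i + d, by omega⟩) (Fin.le_def.2 (by simp)) rfl
    have h2 := deck_symm_strictMono ω (s := s) (i := ⟨i + d, by omega⟩) (i' := i')
      (by simp; omega) (Fin.lt_def.2 (by simp; omega))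
    rw [Fin.lt_def] at h2
    simp only at h1
    omega

/-- A card `i` not yet touched moves to the left at time `s` iff the card `s < i` is reinserted
to its right. -/
theorem deck_succ_symm_of_lt {n : ℕ} (ω : Fin (n + 1) → Fin (n + 1)) {c i : Fin (n + 1)}
    (h : (deck ω c).symm c < (deck ω c).symm i) :
    ((deck ω (c + 1)).symm i : ℕ) + 1 =
      (deck ω c).symm i + if (ω c : ℕ) < (deck ω c).symm i then 1 else 0 := by
  have hne : i ≠ c := by rintro rfl; exact lt_irrefl _ h
  rw [Fin.lt_def] at h
  rw [deck_succ, moveCard_symm_of_ne _ hne, if_pos h]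
  split_ifs <;> omega

/-- A removal on the right does not shift `i`, so insertion exactly at the position of `i` already
pushes it: hence the `+ 1` in the comparison. -/
theorem deck_succ_symm_of_gt {n : ℕ} (ω : Fin (n + 1) → Fin (n + 1)) {c i : Fin (n + 1)}
    (h : (deck ω c).symm i < (deck ω c).symm c) :
    ((deck ω (c + 1)).symm i : ℕ) =
      (deck ω c).symm i + if (ω c : ℕ) < (deck ω c).symm i + 1 then 1 else 0 := by
  have hne : i ≠ c := by rintro rfl; exact lt_irrefl _ h
  rw [Fin.lt_def] at h
  rw [deck_succ, moveCard_symm_of_ne _ hne, if_neg h.not_gt]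
  split_ifs <;> omega

theorem deck_succ_symm_self {n : ℕ} (ω : Fin (n + 1) → Fin (n + 1)) (c : Fin (n + 1)) :
    (deck ω (c + 1)).symm c = ω c := by
  rw [deck_succ, moveCard_symm_self]

/-! ### Resampling and martingale bounds -/

/-- Resampling one coordinate does not change the average. -/
theorem expect_update {n : ℕ} (c : Fin (n + 1)) (F : (Fin (n + 1) → Fin (n + 1)) → ℝ) :
    𝔼 ω, F ω = 𝔼 ω, 𝔼 k, F (Function.update ω c k) := by
  rw [← Finset.expect_product' Finset.univ Finset.univ
    (fun ω k => F (Function.update ω c k)), Finset.univ_product_univ]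
  have h : 𝔼 ω, F ω = 𝔼 z : (Fin (n + 1) → Fin (n + 1)) × Fin (n + 1), F z.1 := by
    rw [← Finset.univ_product_univ, Finset.expect_product]
    simp
  rw [h]
  -- Exchanging the old and the new value of coordinate `c` is an involution.
  refine Finset.expect_nbij' (fun z => (Function.update z.1 c z.2, z.1 c))
    (fun z => (Function.update z.1 c z.2, z.1 c)) ?_ ?_ ?_ ?_ ?_ <;> simp

theorem expect_lt_indicator {n : ℕ} {m : ℕ} (hm : m ≤ n + 1) :
    𝔼 k : Fin (n + 1), (if (k : ℕ) < m then (1 : ℝ) else 0) = m / ((n : ℝ) + 1) := by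
  rw [Fintype.expect_eq_sum_div_card, Finset.sum_boole, Fintype.card_fin]
  have := Fin.card_filter_val_lt (n := n + 1) (m := m)
  rw [this, min_eq_right hm]
  push_cast
  rfl

/-- Mean square displacement of a martingale with bounded increments. -/
theorem expect_sq_sub_le {n : ℕ} (X : ℕ → (Fin (n + 1) → Fin (n + 1)) → ℝ) (C : ℝ) {a t : ℕ}
    (hat : a ≤ t) (ht : t ≤ n + 1)
    (hX : ∀ s, a ≤ s → s ≤ t → ∀ c : Fin (n + 1), s ≤ c → ∀ ω k,
      X s (Function.update ω c k) = X s ω)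
    (hmart : ∀ c : Fin (n + 1), a ≤ c → (c : ℕ) < t → ∀ ω,
      𝔼 k, (X (c + 1) (Function.update ω c k) - X c ω) = 0)
    (hC : ∀ c : Fin (n + 1), a ≤ c → (c : ℕ) < t → ∀ ω, |X (c + 1) ω - X c ω| ≤ C) :
    𝔼 ω, (X t ω - X a ω) ^ 2 ≤ C ^ 2 * (t - a : ℕ) := by
  induction t, hat using Nat.le_induction with
  | base => simp
  | succ t hat ih =>
    have ih' := ih (by omega) (fun s h1 h2 => hX s h1 (by omega))
      (fun c h1 h2 => hmart c h1 (by omega)) (fun c h1 h2 => hC c h1 (by omega))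
    obtain ⟨c, rfl⟩ : ∃ c : Fin (n + 1), (c : ℕ) = t := ⟨⟨t, by omega⟩, rfl⟩
    -- Averaging over coordinate `c` plays the role of conditional expectation given the earlier
    -- coordinates; the cross term then vanishes.
    rw [expect_update c]
    have key : ∀ ω, 𝔼 k, (X (c + 1) (Function.update ω c k) - X a (Function.update ω c k)) ^ 2
        ≤ (X c ω - X a ω) ^ 2 + C ^ 2 := by
      intro ω
      have e : ∀ k, (X (c + 1) (Function.update ω c k) - X a (Function.update ω c k)) ^ 2 =
          (X c ω - X a ω) ^ 2 + (X (c + 1) (Function.update ω c k) - X c ω) ^ 2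
          + 2 * (X c ω - X a ω) * (X (c + 1) (Function.update ω c k) - X c ω) := by
        intro k
        rw [hX a le_rfl (by omega) c hat]
        ring
      simp only [e]
      rw [Finset.expect_add_distrib, Finset.expect_add_distrib, ← Finset.mul_expect,
        hmart c hat (by omega), Fintype.expect_const]
      have : 𝔼 k, (X (c + 1) (Function.update ω c k) - X c ω) ^ 2 ≤ C ^ 2 := by
        refine Finset.expect_le Finset.univ_nonempty fun k _ => ?_
        rw [← hX c hat (by omega) c le_rfl ω k]
        exact sq_le_sq' (by linarith [neg_le_of_abs_le (hC c hat (by omega)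
          (Function.update ω c k))]) (le_of_abs_le (hC c hat (by omega) _))
      linarith
    calc _ ≤ 𝔼 ω, ((X c ω - X a ω) ^ 2 + C ^ 2) := Finset.expect_le_expect fun ω _ => key ω
      _ = 𝔼 ω, (X c ω - X a ω) ^ 2 + C ^ 2 := by
        rw [Finset.expect_add_distrib, Fintype.expect_const]
      _ ≤ C ^ 2 * ((c : ℕ) - a : ℕ) + C ^ 2 := by linarith
      _ = _ := by
        rw [Nat.sub_add_comm hat]; push_cast; ring

theorem expect_abs_le_of_sq {ι : Type*} [Fintype ι] [Nonempty ι] (f : ι → ℝ) {A : ℝ}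
    (h : 𝔼 i, f i ^ 2 ≤ A) : 𝔼 i, |f i| ≤ √A := by
  apply Real.le_sqrt_of_sq_le
  refine le_trans ?_ h
  have := Finset.expect_mul_sq_le_sq_mul_sq Finset.univ (fun i => |f i|) (fun _ => (1 : ℝ))
  simpa using this

theorem expect_abs_sub_le {n : ℕ} (X : ℕ → (Fin (n + 1) → Fin (n + 1)) → ℝ) (C : ℝ) (hC0 : 0 ≤ C)
    {a t : ℕ} (hat : a ≤ t) (ht : t ≤ n + 1)
    (hX : ∀ s, a ≤ s → s ≤ t → ∀ c : Fin (n + 1), s ≤ c → ∀ ω k,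
      X s (Function.update ω c k) = X s ω)
    (hmart : ∀ c : Fin (n + 1), a ≤ c → (c : ℕ) < t → ∀ ω,
      𝔼 k, (X (c + 1) (Function.update ω c k) - X c ω) = 0)
    (hC : ∀ c : Fin (n + 1), a ≤ c → (c : ℕ) < t → ∀ ω, |X (c + 1) ω - X c ω| ≤ C) :
    𝔼 ω, |X t ω - X a ω| ≤ C * √((n : ℝ) + 1) := by
  have h := expect_sq_sub_le X C hat ht hX hmart hC
  have h2 : C ^ 2 * ((t - a : ℕ) : ℝ) ≤ C ^ 2 * ((n : ℝ) + 1) := by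
    have : ((t - a : ℕ) : ℝ) ≤ ((n + 1 : ℕ) : ℝ) := by exact_mod_cast (by omega)
    push_cast at this
    gcongr
  refine (expect_abs_le_of_sq _ (h.trans h2)).trans_eq ?_
  rw [Real.sqrt_mul (sq_nonneg C), Real.sqrt_sq hC0]

/-! ### Growth of the number of cards to the right of an untouched card -/

/-- The growth factor of the number of cards on one side of a card, per reinsertion. -/
noncomputable def growth (n : ℕ) : ℝ := 1 + 1 / ((n : ℝ) + 1)

theorem one_le_growth (n : ℕ) : 1 ≤ growth n := by
  unfold growth
  have : (0 : ℝ) < (n : ℝ) + 1 := by positivity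
  simp only [le_add_iff_nonneg_right]
  positivity

/-- (1 + 1/N)^N ≤ e < 3; this is the source of the constant 3 in the later bounds. -/
theorem growth_pow_le (n : ℕ) {k : ℕ} (hk : k ≤ n + 1) : growth n ^ k ≤ 3 := by
  have hN : (0 : ℝ) < (n : ℝ) + 1 := by positivity
  calc growth n ^ k ≤ growth n ^ (n + 1) := pow_le_pow_right₀ (one_le_growth n) hk
    _ ≤ (exp (1 / ((n : ℝ) + 1))) ^ (n + 1) := by
        have := Real.add_one_le_exp (1 / ((n : ℝ) + 1))
        have h1 := one_le_growth n
        unfold growth at *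
        gcongr
        linarith
    _ = exp 1 := by
        rw [← Real.exp_nat_mul]; congr 1; push_cast; field_simp
    _ ≤ 3 := by linarith [Real.exp_one_lt_d9]

theorem abs_sub_le_one_of_mem {x y : ℝ} (hx0 : 0 ≤ x) (hx1 : x ≤ 1) (hy0 : 0 ≤ y) (hy1 : y ≤ 1) :
    |x - y| ≤ 1 := abs_sub_le_iff.2 ⟨by linarith, by linarith⟩

/-- Before the card `j` is reinserted, the number of cards to the right of an untouched card `i` is
close to its mean. -/
theorem expect_abs_untouched_le {n : ℕ} {j i : Fin (n + 1)} (hij : j ≤ i) :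
    𝔼 ω, |((n : ℝ) + 1 - (deck ω j).symm i) - ((n : ℝ) + 1 - i) * growth n ^ (j : ℕ)|
      ≤ 3 * √((n : ℝ) + 1) := by
  have hN : (0 : ℝ) < (n : ℝ) + 1 := by positivity
  -- Multiplying the count at time s by `growth n ^ (j - s)` cancels its drift: the increment is a
  -- multiple of a centred indicator.
  have step : ∀ c : Fin (n + 1), c < j → ∀ ω,
      ((n : ℝ) + 1 - (deck ω (c + 1)).symm i) * growth n ^ (j - (c + 1) : ℕ) -
      ((n : ℝ) + 1 - (deck ω c).symm i) * growth n ^ (j - c : ℕ) =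
      growth n ^ (j - (c + 1) : ℕ) * ((((deck ω c).symm i : ℕ) : ℝ) / ((n : ℝ) + 1) -
        if (ω c : ℕ) < (deck ω c).symm i then 1 else 0) := by
    intro c hc ω
    have h := deck_succ_symm_of_lt ω (deck_symm_strictMono ω le_rfl (hc.trans_le hij))
    have h' : (((deck ω (c + 1)).symm i : ℕ) : ℝ) + 1 = ((deck ω c).symm i : ℕ) +
      if (ω c : ℕ) < (deck ω c).symm i then 1 else 0 := by exact_mod_cast h
    have e : (j - c : ℕ) = (j - (c + 1) : ℕ) + 1 := by
      have := Fin.lt_def.1 hc; omega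
    rw [e, pow_succ, eq_sub_of_add_eq h']
    nth_rewrite 3 [growth]
    field_simp
    ring
  have := expect_abs_sub_le
    (fun s ω => ((n : ℝ) + 1 - (deck ω s).symm i) * growth n ^ (j - s : ℕ)) 3 (by norm_num)
    (Nat.zero_le j) j.2.le ?_ ?_ ?_
  · have e : (Equiv.symm (1 : Equiv.Perm (Fin (n + 1)))) i = i := rfl
    simpa [deck, e] using this
  · intro s _ _ c hsc ω k
    simp only [deck_update ω c k hsc]
  · intro c _ hc ω
    have e : ∀ k, deck (Function.update ω c k) c = deck ω c := fun k => deck_update ω c k le_rfl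
    have : ∀ k, ((n : ℝ) + 1 - (deck (Function.update ω c k) (c + 1)).symm i) *
        growth n ^ (j - (c + 1) : ℕ) - ((n : ℝ) + 1 - (deck ω c).symm i) * growth n ^ (j - c : ℕ) =
      growth n ^ (j - (c + 1) : ℕ) * ((((deck ω c).symm i : ℕ) : ℝ) / ((n : ℝ) + 1) -
        if (k : ℕ) < (deck ω c).symm i then 1 else 0) := by
      intro k
      have := step c (Fin.lt_def.2 hc) (Function.update ω c k)
      simpa only [e, Function.update_self] using this
    simp only [this]
    rw [← Finset.mul_expect, Finset.expect_sub_distrib, Fintype.expect_const,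
      expect_lt_indicator ((deck ω c).symm i).2.le, sub_self, mul_zero]
  · intro c _ hc ω
    simp only [step c (Fin.lt_def.2 hc)]
    have hg := growth_pow_le n (k := j - (c + 1)) (by omega)
    have hg0 : 0 ≤ growth n ^ (j - (c + 1) : ℕ) := pow_nonneg (by linarith [one_le_growth n]) _
    have hp : (((deck ω c).symm i : ℕ) : ℝ) ≤ (n : ℝ) + 1 := by
      exact_mod_cast ((deck ω c).symm i).2.le
    rw [abs_mul, abs_of_nonneg hg0]
    have : |(((deck ω c).symm i : ℕ) : ℝ) / ((n : ℝ) + 1) -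
        if (ω c : ℕ) < (deck ω c).symm i then 1 else 0| ≤ 1 := by
      apply abs_sub_le_one_of_mem (by positivity) ((div_le_one hN).2 hp) <;> split_ifs <;> norm_num
    nlinarith

/-! ### The clearing time and the motion of a card after its reinsertion -/

/-- The time at which all untouched cards to the left of card `j` (after its reinsertion) have
been moved. -/
noncomputable def clearTime {n : ℕ} (j : Fin (n + 1)) (ω : Fin (n + 1) → Fin (n + 1)) : ℕ :=
  j + 1 + (Finset.univ.filter fun i => j < i ∧
    (deck ω (j + 1)).symm i < (deck ω (j + 1)).symm j).card

theorem succ_le_clearTime {n : ℕ} (j : Fin (n + 1)) (ω : Fin (n + 1) → Fin (n + 1)) :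
    j + 1 ≤ clearTime j ω := Nat.le_add_right _ _

theorem clearTime_le {n : ℕ} (j : Fin (n + 1)) (ω : Fin (n + 1) → Fin (n + 1)) :
    clearTime j ω ≤ n + 1 := by
  have : (Finset.univ.filter fun i => j < i ∧
      (deck ω (j + 1)).symm i < (deck ω (j + 1)).symm j).card ≤ (Finset.Ioi j).card :=
    Finset.card_le_card fun i hi => by simp at hi ⊢; exact hi.1
  rw [Fin.card_Ioi] at this
  unfold clearTime
  omega

/-- The untouched cards are in increasing order, so those left of `j` are `j + 1, j + 2, …` without
gaps, and their number determines them. -/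
theorem lt_clearTime_iff {n : ℕ} {j i : Fin (n + 1)} (hij : j < i)
    (ω : Fin (n + 1) → Fin (n + 1)) :
    i < clearTime j ω ↔ (deck ω (j + 1)).symm i < (deck ω (j + 1)).symm j := by
  have hij' := Fin.lt_def.1 hij
  have mono : ∀ {i i' : Fin (n + 1)}, j < i → i ≤ i' →
      (deck ω (j + 1)).symm i ≤ (deck ω (j + 1)).symm i' := by
    intro i i' h h'
    rcases h'.eq_or_lt with rfl | h'
    · exact le_rfl
    · exact (deck_symm_strictMono ω (Nat.succ_le_of_lt (Fin.lt_def.1 h)) h').le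
  unfold clearTime
  constructor
  · intro h
    by_contra hcon
    have : (Finset.univ.filter fun i => j < i ∧
        (deck ω (j + 1)).symm i < (deck ω (j + 1)).symm j).card ≤ (Finset.Ioo j i).card := by
      refine Finset.card_le_card fun i' hi => ?_
      simp only [Finset.mem_filter, Finset.mem_univ, true_and, Finset.mem_Ioo] at hi ⊢
      refine ⟨hi.1, lt_of_not_ge fun hle => hcon ((mono hij hle).trans_lt hi.2)⟩
    rw [Fin.card_Ioo] at this
    omega
  · intro h
    have : (Finset.Ioc j i).card ≤ (Finset.univ.filter fun i => j < i ∧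
        (deck ω (j + 1)).symm i < (deck ω (j + 1)).symm j).card := by
      refine Finset.card_le_card fun i' hi => ?_
      simp only [Finset.mem_filter, Finset.mem_univ, true_and, Finset.mem_Ioc] at hi ⊢
      exact ⟨hi.1, (mono hi.1 hi.2).trans_lt h⟩
    rw [Fin.card_Ioc] at this
    omega

theorem lt_clearTime_iff_deck {n : ℕ} {j c : Fin (n + 1)} (hij : j < c)
    (ω : Fin (n + 1) → Fin (n + 1)) :
    c < clearTime j ω ↔ (deck ω c).symm c < (deck ω c).symm j := by
  have h := Fin.lt_def.1 hij
  rw [lt_clearTime_iff hij,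
    deck_symm_lt_iff ω (Nat.succ_le_of_lt h) (Or.inr le_rfl) (Or.inl (Nat.lt_succ_self _))]

theorem clearTime_update {n : ℕ} {j c : Fin (n + 1)} (h : j < c)
    (ω : Fin (n + 1) → Fin (n + 1)) (k : Fin (n + 1)) :
    clearTime j (Function.update ω c k) = clearTime j ω := by
  unfold clearTime
  rw [deck_update ω c k (Nat.succ_le_of_lt (Fin.lt_def.1 h))]

/-- The conditional expectation of the final position (counted from `1`) of card `j`, when it is in
position `x` at time `s` and the untouched cards to its left are used up at time `T`. -/
noncomputable def predicted (n T s : ℕ) (x : ℝ) : ℝ :=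
  if s < T then growth n ^ (n + 1 - T) * ((n : ℝ) + 2 - ((n : ℝ) + 1 - x) * growth n ^ (T - s))
  else growth n ^ (n + 1 - s) * (x + 1)

/-- The two branches agree at s = T, so the martingale passes from one regime to the other without a
jump. -/
theorem predicted_of_le {n T s : ℕ} (x : ℝ) (h : s ≤ T) :
    predicted n T s x =
      growth n ^ (n + 1 - T) * ((n : ℝ) + 2 - ((n : ℝ) + 1 - x) * growth n ^ (T - s)) := by
  unfold predicted
  split_ifs with h'
  · rfl
  · obtain rfl : s = T := by omega
    simp only [Nat.sub_self, pow_zero]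
    ring

/-- Each increment is a bounded multiple of a centred indicator in both regimes, which gives the
martingale property and the bound 3 together. The threshold `m` is the position of `j` before
clearing and one more after it. -/
theorem predicted_succ_sub {n : ℕ} {j c : Fin (n + 1)} (hc : j < c)
    (ω : Fin (n + 1) → Fin (n + 1)) :
    ∃ g : ℝ, 0 ≤ g ∧ g ≤ 3 ∧ ∃ m ≤ n + 1, ∀ k : Fin (n + 1),
      predicted n (clearTime j ω) (c + 1)
        ((deck (Function.update ω c k) (c + 1)).symm j : ℕ) -
      predicted n (clearTime j ω) c ((deck ω c).symm j : ℕ) =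
      g * ((if (k : ℕ) < m then 1 else 0) - (m : ℝ) / ((n : ℝ) + 1)) := by
  have hN : (0 : ℝ) < (n : ℝ) + 1 := by positivity
  have hg0 : ∀ m, 0 ≤ growth n ^ m := fun m => pow_nonneg (by linarith [one_le_growth n]) _
  have hd : ∀ k, deck (Function.update ω c k) c = deck ω c := fun k => deck_update ω c k le_rfl
  by_cases h : c < clearTime j ω
  · have hT := clearTime_le j ω
    refine ⟨growth n ^ (n + 1 - clearTime j ω) * growth n ^ (clearTime j ω - (c + 1)), ?_, ?_,
      (deck ω c).symm j, ((deck ω c).symm j).2.le, fun k => ?_⟩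
    · exact mul_nonneg (hg0 _) (hg0 _)
    · rw [← pow_add]; exact growth_pow_le n (by omega)
    · have hs := deck_succ_symm_of_lt (Function.update ω c k) (c := c) (i := j)
        (by rw [hd]; exact (lt_clearTime_iff_deck hc ω).1 h)
      rw [hd, Function.update_self] at hs
      have hs' : (((deck (Function.update ω c k) (c + 1)).symm j : ℕ) : ℝ) + 1 =
        ((deck ω c).symm j : ℕ) + if (k : ℕ) < (deck ω c).symm j then 1 else 0 := by
        exact_mod_cast hs
      have e : clearTime j ω - (c : ℕ) = (clearTime j ω - (c + 1)) + 1 := by omega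
      have h1 : (c : ℕ) + 1 ≤ clearTime j ω := h
      rw [predicted_of_le _ h1, predicted_of_le _ h.le, e, pow_succ, eq_sub_of_add_eq hs']
      generalize growth n ^ (n + 1 - clearTime j ω) = A
      generalize growth n ^ (clearTime j ω - (c + 1)) = B
      rw [growth]
      field_simp
      ring
  · refine ⟨growth n ^ (n + 1 - (c + 1)), hg0 _, growth_pow_le n (by omega),
      (deck ω c).symm j + 1, ((deck ω c).symm j).2, fun k => ?_⟩
    have hne : (deck ω c).symm j ≠ (deck ω c).symm c := fun e =>
      hc.ne ((deck ω c).symm.injective e)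
    have hs := deck_succ_symm_of_gt (Function.update ω c k) (c := c) (i := j)
      (by rw [hd]; exact lt_of_le_of_ne (not_lt.1 ((lt_clearTime_iff_deck hc ω).not.1 h)) hne)
    rw [hd, Function.update_self] at hs
    have e : n + 1 - (c : ℕ) = (n + 1 - (c + 1)) + 1 := by omega
    rw [predicted, if_neg (by omega), predicted, if_neg h, hs, e, pow_succ]
    nth_rewrite 3 [growth]
    push_cast
    field_simp
    ring

theorem expect_abs_final_sub_predicted_le {n : ℕ} (j : Fin (n + 1)) :
    𝔼 ω, |(((deck ω (n + 1)).symm j : ℕ) : ℝ) + 1 -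
      predicted n (clearTime j ω) (j + 1) (ω j : ℕ)| ≤ 3 * √((n : ℝ) + 1) := by
  have := expect_abs_sub_le
    (fun s ω => predicted n (clearTime j ω) s ((deck ω s).symm j : ℕ)) 3 (by norm_num)
    (a := j + 1) (t := n + 1) j.2 le_rfl ?_ ?_ ?_
  · refine le_trans (le_of_eq ?_) this
    refine Finset.expect_congr rfl fun ω _ => ?_
    have hT := clearTime_le j ω
    have e : predicted n (clearTime j ω) (n + 1) ((deck ω (n + 1)).symm j : ℕ) =
        ((deck ω (n + 1)).symm j : ℕ) + 1 := by
      rw [predicted, if_neg (by omega : ¬ n + 1 < clearTime j ω)]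
      simp
    rw [e, deck_succ_symm_self]
  · intro s hs _ c hsc ω k
    have hjc : j < c := Fin.lt_def.2 (by omega)
    simp only [deck_update ω c k hsc, clearTime_update hjc]
  · intro c hc _ ω
    have hjc : j < c := Fin.lt_def.2 (by omega)
    obtain ⟨g, _, _, m, hm, h⟩ := predicted_succ_sub hjc ω
    simp only [clearTime_update hjc, h]
    rw [← Finset.mul_expect, Finset.expect_sub_distrib, Fintype.expect_const,
      expect_lt_indicator hm, sub_self, mul_zero]
  · intro c hc _ ω
    have hjc : j < c := Fin.lt_def.2 (by omega)
    obtain ⟨g, hg0, hg3, m, hm, h⟩ := predicted_succ_sub hjc ω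
    have h' := h (ω c)
    rw [Function.update_eq_self] at h'
    simp only [h']
    rw [abs_mul, abs_of_nonneg hg0]
    have hm' : (m : ℝ) ≤ (n : ℝ) + 1 := by exact_mod_cast hm
    have : |(if (ω c : ℕ) < m then 1 else 0) - (m : ℝ) / ((n : ℝ) + 1)| ≤ 1 := by
      apply abs_sub_le_one_of_mem _ _ (by positivity) ((div_le_one (by positivity)).2 hm') <;>
        split_ifs <;> norm_num
    nlinarith

/-! ### Concentration of the clearing time -/

/-- The untouched card that is expected in position `k` when card `j` is reinserted there (or `j` if
there is none). -/
noncomputable def expectedCard {n : ℕ} (j k : Fin (n + 1)) : ℕ :=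
  max j ⌊(n : ℝ) + 1 - ((n : ℝ) + 1 - k) / growth n ^ (j : ℕ)⌋₊

theorem expectedCard_arg_mem {n : ℕ} (j k : Fin (n + 1)) :
    (n : ℝ) + 1 - ((n : ℝ) + 1 - k) / growth n ^ (j : ℕ) ∈ Ico 0 ((n : ℝ) + 1) := by
  have hk : ((k : ℕ) : ℝ) + 1 ≤ (n : ℝ) + 1 := by exact_mod_cast k.2
  have hg : 1 ≤ growth n ^ (j : ℕ) := one_le_pow₀ (one_le_growth n)
  constructor
  · have : ((n : ℝ) + 1 - k) / growth n ^ (j : ℕ) ≤ (n : ℝ) + 1 - k :=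
      div_le_self (by linarith) hg
    have : (0 : ℝ) ≤ (k : ℕ) := Nat.cast_nonneg _
    linarith
  · have : 0 < ((n : ℝ) + 1 - k) / growth n ^ (j : ℕ) := div_pos (by linarith) (by linarith)
    linarith

theorem expectedCard_lt {n : ℕ} (j k : Fin (n + 1)) : expectedCard j k < n + 1 := by
  refine max_lt j.2 ?_
  rw [Nat.floor_lt (expectedCard_arg_mem j k).1]
  exact_mod_cast (expectedCard_arg_mem j k).2

theorem lt_clearTime_iff_le {n : ℕ} {j i : Fin (n + 1)} (hij : j < i)
    (ω : Fin (n + 1) → Fin (n + 1)) :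
    i < clearTime j ω ↔ ((deck ω j).symm i : ℕ) ≤ ω j := by
  have h := deck_succ_symm_of_lt ω (c := j) (i := i) (deck_symm_strictMono ω le_rfl hij)
  rw [lt_clearTime_iff hij, deck_succ_symm_self, Fin.lt_def]
  split_ifs at h <;> omega

/-- By `deck_symm_expand`, the clearing time misses card `i` by no more, up to one, than the
position of `i` misses `ω j`. The 4 covers the floor, which costs at most `growth n ^ j ≤ 3`, and
this shift by one. -/
theorem abs_clearTime_sub_le {n : ℕ} (j : Fin (n + 1)) (ω : Fin (n + 1) → Fin (n + 1))
    (i : Fin (n + 1)) (hi : (i : ℕ) = expectedCard j (ω j)) :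
    |(clearTime j ω : ℝ) - 1 - i| ≤
      |((n : ℝ) + 1 - (deck ω j).symm i) - ((n : ℝ) + 1 - i) * growth n ^ (j : ℕ)| + 4 := by
  have hT1 := succ_le_clearTime j ω
  have hTn := clearTime_le j ω
  have hg : 0 < growth n ^ (j : ℕ) := pow_pos (by linarith [one_le_growth n]) _
  have hg3 := growth_pow_le n j.2.le
  have hmem := expectedCard_arg_mem j (ω j)
  set y := (n : ℝ) + 1 - ((n : ℝ) + 1 - ω j) / growth n ^ (j : ℕ) with hy
  have hyr : ((n : ℝ) + 1 - y) * growth n ^ (j : ℕ) = (n : ℝ) + 1 - ω j := by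
    rw [hy]; field_simp; ring
  have hji : j ≤ i := Fin.le_def.2 (by rw [hi]; exact le_max_left _ _)
  have hji' := Fin.le_def.1 hji
  have hyi : y < i + 1 := by
    have h1 := Nat.lt_floor_add_one y
    have h2 : ⌊y⌋₊ ≤ (i : ℕ) := by rw [hi]; exact le_max_right _ _
    have h3 : ((⌊y⌋₊ : ℕ) : ℝ) ≤ (i : ℕ) := by exact_mod_cast h2
    linarith
  set D := |((n : ℝ) + 1 - (deck ω j).symm i) - ((n : ℝ) + 1 - i) * growth n ^ (j : ℕ)| with hD
  have hD1 := (abs_le.1 (le_of_eq hD.symm)).1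
  have hD2 := (abs_le.1 (le_of_eq hD.symm)).2
  have hD0 : 0 ≤ D := abs_nonneg _
  have upper : (clearTime j ω : ℝ) - 1 - i ≤ D + 4 := by
    by_cases hcase : clearTime j ω ≤ i + 1
    · have : (clearTime j ω : ℝ) ≤ i + 1 := by exact_mod_cast hcase
      linarith
    · let t : Fin (n + 1) := ⟨clearTime j ω - 1, by omega⟩
      have htv : (t : ℕ) = clearTime j ω - 1 := rfl
      have h1 := (lt_clearTime_iff_le (j := j) (i := t) (Fin.lt_def.2 (by omega)) ω).1 (by omega)
      have h2 := deck_symm_expand ω (s := j) hji' (i' := t) (Fin.le_def.2 (by omega))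
      have h3 : ((deck ω j).symm i : ℕ) + clearTime j ω ≤ (ω j : ℕ) + 1 + i := by omega
      have h3' : (((deck ω j).symm i : ℕ) : ℝ) + clearTime j ω ≤ (ω j : ℕ) + 1 + i := by
        exact_mod_cast h3
      nlinarith
  have lower : -(D + 4) ≤ (clearTime j ω : ℝ) - 1 - i := by
    by_cases hcase : i + 1 ≤ clearTime j ω
    · have : (i : ℝ) + 1 ≤ clearTime j ω := by exact_mod_cast hcase
      linarith
    · let t : Fin (n + 1) := ⟨clearTime j ω, by omega⟩
      have htv : (t : ℕ) = clearTime j ω := rfl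
      have h1 := (lt_clearTime_iff_le (j := j) (i := t) (Fin.lt_def.2 (by omega)) ω).not.1
        (by omega)
      have h2 := deck_symm_expand ω (s := j) (i := t) (by omega) (i' := i)
        (Fin.le_def.2 (by omega))
      have h3 : (ω j : ℕ) + i ≤ ((deck ω j).symm i : ℕ) + clearTime j ω := by omega
      have h3' : ((ω j : ℕ) : ℝ) + i ≤ ((deck ω j).symm i : ℕ) + clearTime j ω := by
        exact_mod_cast h3
      have hiy : (i : ℝ) ≤ y := by
        rcases le_total (j : ℕ) ⌊y⌋₊ with h | h
        · have : (i : ℕ) = ⌊y⌋₊ := by rw [hi]; exact max_eq_right h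
          rw [this]
          exact Nat.floor_le hmem.1
        · have : (i : ℕ) = j := by rw [hi]; exact max_eq_left h
          omega
      nlinarith
  exact abs_le.2 ⟨lower, upper⟩

theorem expect_abs_clearTime_sub_le {n : ℕ} (j : Fin (n + 1)) :
    𝔼 ω, |(clearTime j ω : ℝ) - 1 - expectedCard j (ω j)| ≤ 3 * √((n : ℝ) + 1) + 4 := by
  -- `deck ω j` does not depend on coordinate `j`, so for a fixed reinsertion position `k` the card
  -- to be controlled is deterministic.
  rw [expect_update j, Finset.expect_comm]
  refine Finset.expect_le Finset.univ_nonempty fun k _ => ?_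
  let i : Fin (n + 1) := ⟨expectedCard j k, expectedCard_lt j k⟩
  have h : ∀ ω, |(clearTime j (Function.update ω j k) : ℝ) - 1 -
      expectedCard j (Function.update ω j k j)| ≤
      |((n : ℝ) + 1 - (deck ω j).symm i) - ((n : ℝ) + 1 - i) * growth n ^ (j : ℕ)| + 4 := by
    intro ω
    have := abs_clearTime_sub_le j (Function.update ω j k) i (by simp [i])
    rw [deck_update ω j k le_rfl] at this
    simpa [i] using this
  refine (Finset.expect_le_expect fun ω _ => h ω).trans ?_
  rw [Finset.expect_add_distrib, Fintype.expect_const]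
  linarith [expect_abs_untouched_le (j := j) (i := i) (Fin.le_def.2 (le_max_left _ _))]

/-! ### The limiting position as a function of the reinsertion position -/

/-- The limiting rescaled final position of a card with a number around `b` times the size of the
deck which is reinserted at height `u`. -/
noncomputable def limitPosition (b u : ℝ) : ℝ :=
  exp (min ((1 - u) * exp (-b)) (1 - b)) - (1 - u) * exp (1 - b)

/-- The exponential rate when one full pass through the deck is the unit of time; it tends to 1. -/
noncomputable def growthRate (n : ℕ) : ℝ := ((n : ℝ) + 1) * log (growth n)

theorem growthRate_le_one (n : ℕ) : growthRate n ≤ 1 := by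
  have h1 := one_le_growth n
  have h := Real.log_le_sub_one_of_pos (lt_of_lt_of_le one_pos h1)
  have hN : (0 : ℝ) < (n : ℝ) + 1 := by positivity
  have e : ((n : ℝ) + 1) * (growth n - 1) = 1 := by
    unfold growth; field_simp; ring
  unfold growthRate
  nlinarith

theorem growth_pow_eq_exp (n k : ℕ) :
    growth n ^ k = exp (growthRate n * (k / ((n : ℝ) + 1))) := by
  have hN : (0 : ℝ) < (n : ℝ) + 1 := by positivity
  have : growthRate n * (k / ((n : ℝ) + 1)) = k * log (growth n) := by
    unfold growthRate; field_simp
  rw [this, Real.exp_nat_mul, Real.exp_log (lt_of_lt_of_le one_pos (one_le_growth n))]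

theorem tendsto_growthRate : Tendsto growthRate atTop (𝓝 1) := by
  have h := (Real.tendsto_mul_log_one_add_div_atTop 1).comp
    ((tendsto_natCast_atTop_atTop (R := ℝ)).comp (tendsto_add_atTop_nat 1))
  refine h.congr fun n => ?_
  simp [growthRate, growth]

theorem abs_exp_sub_exp_le {x y : ℝ} (hx : x ≤ 1) (hy : y ≤ 1) :
    |exp x - exp y| ≤ 3 * |x - y| := by
  wlog hxy : y ≤ x generalizing x y
  · rw [abs_sub_comm, abs_sub_comm x]
    exact this hy hx (le_of_not_ge hxy)
  rw [abs_of_nonneg (sub_nonneg.2 (exp_le_exp.2 hxy)), abs_of_nonneg (sub_nonneg.2 hxy)]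
  have h1 : exp x ≤ 3 := (exp_le_exp.2 hx).trans (by linarith [exp_one_lt_d9])
  have h2 : exp y = exp x * exp (y - x) := by rw [← exp_add]; congr 1; ring
  have h3 := Real.add_one_le_exp (y - x)
  have h4 := exp_pos x
  nlinarith

/-- The first two terms are the random errors already bounded by O(√N) in mean; the others are
deterministic and vanish along a card sequence. Of the 2/N, one half is the floor in `expectedCard`,
the other the extra unit in `predicted`. -/
theorem abs_final_sub_limit_le {n : ℕ} {b : ℝ} (hb0 : 0 ≤ b) (j : Fin (n + 1))
    (ω : Fin (n + 1) → Fin (n + 1)) (Y : ℝ) :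
    |Y / ((n : ℝ) + 1) - limitPosition b ((ω j : ℕ) / ((n : ℝ) + 1))| ≤
      |Y - predicted n (clearTime j ω) (j + 1) (ω j : ℕ)| / ((n : ℝ) + 1) +
      3 * (|(clearTime j ω : ℝ) - 1 - expectedCard j (ω j)| / ((n : ℝ) + 1)) +
      (3 * (|growthRate n - 1| + |((j : ℕ) + 1 : ℝ) / ((n : ℝ) + 1) - b|
        + |(growth n ^ (j : ℕ))⁻¹ - exp (-b)| + 2 / ((n : ℝ) + 1)) +
        |growth n ^ (n - j : ℕ) - exp (1 - b)|) := by
  have hN : (0 : ℝ) < (n : ℝ) + 1 := by positivity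
  have hT1 := succ_le_clearTime j ω
  have hTn := clearTime_le j ω
  have hg : 0 < growth n ^ (j : ℕ) := pow_pos (by linarith [one_le_growth n]) _
  have hmem := expectedCard_arg_mem j (ω j)
  have hk : ((ω j : ℕ) : ℝ) ≤ (n : ℝ) + 1 := by exact_mod_cast (ω j).2.le
  set u := ((ω j : ℕ) : ℝ) / ((n : ℝ) + 1) with hu
  have hu0 : 0 ≤ u := by positivity
  have hu1 : u ≤ 1 := (div_le_one hN).2 hk
  have hku : ((ω j : ℕ) : ℝ) = u * ((n : ℝ) + 1) := by rw [hu]; field_simp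
  set T := clearTime j ω
  set w := (1 - u) * exp (-b) with hw
  have hTN : (T : ℝ) ≤ (n : ℝ) + 1 := by exact_mod_cast hTn
  -- the scaled prediction
  have hpred : predicted n T (j + 1) (ω j : ℕ) / ((n : ℝ) + 1) =
      growth n ^ (n + 1 - T) + growth n ^ (n + 1 - T) / ((n : ℝ) + 1)
        - (1 - u) * growth n ^ (n - j : ℕ) := by
    have e : (n - j : ℕ) = (n + 1 - T) + (T - (j + 1)) := by omega
    rw [predicted_of_le _ hT1, e, pow_add, hku]
    field_simp
    ring
  -- the clearing time
  have hfl1 := Nat.lt_floor_add_one ((n : ℝ) + 1 - ((n : ℝ) + 1 - ω j) / growth n ^ (j : ℕ))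
  have hfl2 := Nat.floor_le hmem.1
  have hmin : |1 - ((expectedCard j (ω j) : ℝ) + 1) / ((n : ℝ) + 1) - min w (1 - b)| ≤
      |((j : ℕ) + 1 : ℝ) / ((n : ℝ) + 1) - b| + |(growth n ^ (j : ℕ))⁻¹ - exp (-b)|
        + 1 / ((n : ℝ) + 1) := by
    unfold expectedCard
    set f := ⌊(n : ℝ) + 1 - ((n : ℝ) + 1 - ω j) / growth n ^ (j : ℕ)⌋₊
    have e : 1 - (((max (j : ℕ) f : ℕ) : ℝ) + 1) / ((n : ℝ) + 1) =
        min (1 - ((f : ℝ) + 1) / ((n : ℝ) + 1)) (1 - ((j : ℕ) + 1 : ℝ) / ((n : ℝ) + 1)) := by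
      rcases le_total (j : ℕ) f with h | h
      · have h' : ((j : ℕ) : ℝ) ≤ f := by exact_mod_cast h
        rw [max_eq_right h, min_eq_left]
        gcongr
      · have h' : (f : ℝ) ≤ (j : ℕ) := by exact_mod_cast h
        rw [max_eq_left h, min_eq_right]
        gcongr
    rw [e]
    refine (abs_min_sub_min_le_max _ _ _ _).trans (max_le ?_ ?_)
    · have e2 : (((n : ℝ) + 1 - ω j) / growth n ^ (j : ℕ)) / ((n : ℝ) + 1) =
          (1 - u) * (growth n ^ (j : ℕ))⁻¹ := by
        rw [hku]; field_simp
      have e3 : |1 - ((f : ℝ) + 1) / ((n : ℝ) + 1) - (1 - u) * (growth n ^ (j : ℕ))⁻¹|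
          ≤ 1 / ((n : ℝ) + 1) := by
        rw [← e2]
        have e4 : 1 - ((f : ℝ) + 1) / ((n : ℝ) + 1) -
            (((n : ℝ) + 1 - ω j) / growth n ^ (j : ℕ)) / ((n : ℝ) + 1) =
            ((n : ℝ) + 1 - ((f : ℝ) + 1) - ((n : ℝ) + 1 - ω j) / growth n ^ (j : ℕ)) /
              ((n : ℝ) + 1) := by
          field_simp
        rw [e4, abs_div, abs_of_pos hN]
        gcongr
        rw [abs_le]
        constructor <;> linarith
      have e5 : |(1 - u) * (growth n ^ (j : ℕ))⁻¹ - w| ≤ |(growth n ^ (j : ℕ))⁻¹ - exp (-b)| := by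
        rw [hw, ← mul_sub, abs_mul, abs_of_nonneg (by linarith : 0 ≤ 1 - u)]
        exact mul_le_of_le_one_left (abs_nonneg _) (by linarith)
      have := abs_sub_le (1 - ((f : ℝ) + 1) / ((n : ℝ) + 1)) ((1 - u) * (growth n ^ (j : ℕ))⁻¹) w
      have := abs_nonneg (((j : ℕ) + 1 : ℝ) / ((n : ℝ) + 1) - b)
      linarith
    · have : 1 - ((j : ℕ) + 1 : ℝ) / ((n : ℝ) + 1) - (1 - b) =
          -(((j : ℕ) + 1 : ℝ) / ((n : ℝ) + 1) - b) := by ring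
      rw [this, abs_neg]
      have := abs_nonneg ((growth n ^ (j : ℕ))⁻¹ - exp (-b))
      have : 0 ≤ 1 / ((n : ℝ) + 1) := by positivity
      linarith
  have hclear : |(1 - T / ((n : ℝ) + 1)) - min w (1 - b)| ≤
      |(T : ℝ) - 1 - expectedCard j (ω j)| / ((n : ℝ) + 1) +
      (|((j : ℕ) + 1 : ℝ) / ((n : ℝ) + 1) - b| + |(growth n ^ (j : ℕ))⁻¹ - exp (-b)|
        + 1 / ((n : ℝ) + 1)) := by
    have e : |(1 - T / ((n : ℝ) + 1)) - (1 - ((expectedCard j (ω j) : ℝ) + 1) / ((n : ℝ) + 1))| =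
        |(T : ℝ) - 1 - expectedCard j (ω j)| / ((n : ℝ) + 1) := by
      rw [← abs_neg, ← abs_of_pos hN, ← abs_div, abs_of_pos hN]
      congr 1
      field_simp
      ring
    rw [← e]
    exact (abs_sub_le _ _ _).trans (by gcongr)
  have hrate : |growthRate n * (1 - T / ((n : ℝ) + 1)) - (1 - T / ((n : ℝ) + 1))| ≤
      |growthRate n - 1| := by
    have h0 : 0 ≤ 1 - T / ((n : ℝ) + 1) := sub_nonneg.2 ((div_le_one hN).2 hTN)
    have h1 : 1 - T / ((n : ℝ) + 1) ≤ 1 := by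
      have : 0 ≤ T / ((n : ℝ) + 1) := by positivity
      linarith
    rw [← sub_one_mul, abs_mul, abs_of_nonneg h0]
    exact mul_le_of_le_one_right (abs_nonneg _) h1
  have hgT : growth n ^ (n + 1 - T) = exp (growthRate n * (1 - T / ((n : ℝ) + 1))) := by
    rw [growth_pow_eq_exp, Nat.cast_sub hTn]
    congr 2
    push_cast
    field_simp
  have hexp : |growth n ^ (n + 1 - T) - exp (min w (1 - b))| ≤
      3 * |growthRate n * (1 - T / ((n : ℝ) + 1)) - min w (1 - b)| := by
    rw [hgT]
    apply abs_exp_sub_exp_le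
    · have h0 : 0 ≤ 1 - T / ((n : ℝ) + 1) := sub_nonneg.2 ((div_le_one hN).2 hTN)
      have h1 : 0 ≤ T / ((n : ℝ) + 1) := by positivity
      have := growthRate_le_one n
      nlinarith
    · exact (min_le_right _ _).trans (by linarith)
  have htri := abs_sub_le (growthRate n * (1 - T / ((n : ℝ) + 1))) (1 - T / ((n : ℝ) + 1))
    (min w (1 - b))
  have hsmall : |growth n ^ (n + 1 - T) / ((n : ℝ) + 1)| ≤ 3 * (1 / ((n : ℝ) + 1)) := by
    have hp : 0 ≤ growth n ^ (n + 1 - T) := pow_nonneg (by linarith [one_le_growth n]) _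
    rw [abs_of_nonneg (by positivity), mul_one_div]
    gcongr
    exact growth_pow_le n (by omega)
  have hlast : |(1 - u) * (growth n ^ (n - j : ℕ) - exp (1 - b))| ≤
      |growth n ^ (n - j : ℕ) - exp (1 - b)| := by
    rw [abs_mul, abs_of_nonneg (by linarith : 0 ≤ 1 - u)]
    exact mul_le_of_le_one_left (abs_nonneg _) (by linarith)
  have hfirst : |(Y - predicted n T (j + 1) (ω j : ℕ)) / ((n : ℝ) + 1)| =
      |Y - predicted n T (j + 1) (ω j : ℕ)| / ((n : ℝ) + 1) := by
    rw [abs_div, abs_of_pos hN]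
  have hsplit : Y / ((n : ℝ) + 1) - limitPosition b u =
      (Y - predicted n T (j + 1) (ω j : ℕ)) / ((n : ℝ) + 1) +
      (growth n ^ (n + 1 - T) - exp (min w (1 - b))) + growth n ^ (n + 1 - T) / ((n : ℝ) + 1) -
      (1 - u) * (growth n ^ (n - j : ℕ) - exp (1 - b)) := by
    rw [sub_div, hpred, limitPosition]
    ring
  rw [hsplit]
  have t1 := abs_sub ((Y - predicted n T (j + 1) (ω j : ℕ)) / ((n : ℝ) + 1) +
      (growth n ^ (n + 1 - T) - exp (min w (1 - b))) + growth n ^ (n + 1 - T) / ((n : ℝ) + 1))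
      ((1 - u) * (growth n ^ (n - j : ℕ) - exp (1 - b)))
  have t2 := abs_add_le ((Y - predicted n T (j + 1) (ω j : ℕ)) / ((n : ℝ) + 1) +
      (growth n ^ (n + 1 - T) - exp (min w (1 - b)))) (growth n ^ (n + 1 - T) / ((n : ℝ) + 1))
  have t3 := abs_add_le ((Y - predicted n T (j + 1) (ω j : ℕ)) / ((n : ℝ) + 1))
      (growth n ^ (n + 1 - T) - exp (min w (1 - b)))
  have e2 : 2 / ((n : ℝ) + 1) = 1 / ((n : ℝ) + 1) + 1 / ((n : ℝ) + 1) := by ring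
  linarith

/-- The rescaled final position of a card is close, in mean, to a function of its reinsertion
position. -/
theorem tendsto_expect_abs_sub_limitPosition {b : ℝ} (hb0 : 0 ≤ b)
    {j : (n : ℕ) → Fin (n + 1)} (hj : IsCardSequence b j) :
    Tendsto (fun n : ℕ => 𝔼 ω : Fin (n + 1) → Fin (n + 1),
      |cardPosition (deck ω (n + 1)) (j n) / ((n : ℝ) + 1) -
        limitPosition b ((ω (j n) : ℕ) / ((n : ℝ) + 1))|) atTop (𝓝 0) := by
  have hinv : Tendsto (fun n : ℕ => 1 / ((n : ℝ) + 1)) atTop (𝓝 0) :=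
    tendsto_one_div_add_atTop_nhds_zero_nat
  have hsqrt : Tendsto (fun n : ℕ => √(1 / ((n : ℝ) + 1))) atTop (𝓝 0) := by
    have := (Real.continuous_sqrt.tendsto 0).comp hinv
    rwa [Real.sqrt_zero] at this
  have hj' : Tendsto (fun n : ℕ => ((j n : ℕ) : ℝ) / ((n : ℝ) + 1)) atTop (𝓝 b) := by
    have := hj.sub hinv
    rw [sub_zero] at this
    refine this.congr fun n => ?_
    rw [← sub_div]; simp
  have hg1 : Tendsto (fun n : ℕ => (growth n ^ (j n : ℕ))⁻¹) atTop (𝓝 (exp (-b))) := by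
    have := (Real.continuous_exp.tendsto _).comp (tendsto_growthRate.mul hj').neg
    rw [one_mul] at this
    refine this.congr fun n => ?_
    simp [growth_pow_eq_exp, Real.exp_neg]
  have hg2 : Tendsto (fun n : ℕ => growth n ^ (n - j n : ℕ)) atTop (𝓝 (exp (1 - b))) := by
    have := (Real.continuous_exp.tendsto _).comp (tendsto_growthRate.mul (hj.const_sub 1))
    rw [one_mul] at this
    refine this.congr fun n => ?_
    simp only [Function.comp]
    rw [growth_pow_eq_exp, Nat.cast_sub (Fin.is_le _)]
    congr 2
    have hN : (0 : ℝ) < (n : ℝ) + 1 := by positivity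
    field_simp
    ring
  have habs : ∀ {f : ℕ → ℝ} {l : ℝ}, Tendsto f atTop (𝓝 l) →
      Tendsto (fun n => |f n - l|) atTop (𝓝 0) := by
    intro f l h
    simpa using (h.sub_const l).abs
  have herr : Tendsto (fun n : ℕ => (3 * √(1 / ((n : ℝ) + 1)) +
      3 * (3 * √(1 / ((n : ℝ) + 1)) + 4 * (1 / ((n : ℝ) + 1))) +
      (3 * (|growthRate n - 1| + |((j n : ℕ) + 1 : ℝ) / ((n : ℝ) + 1) - b|
        + |(growth n ^ (j n : ℕ))⁻¹ - exp (-b)| + 2 * (1 / ((n : ℝ) + 1))) +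
        |growth n ^ (n - j n : ℕ) - exp (1 - b)|))) atTop (𝓝 0) := by
    have := ((hsqrt.const_mul 3).add (((hsqrt.const_mul 3).add (hinv.const_mul 4)).const_mul 3)).add
      ((((((habs tendsto_growthRate).add (habs hj)).add (habs hg1)).add
        (hinv.const_mul 2)).const_mul 3).add (habs hg2))
    simpa using this
  refine squeeze_zero (fun n => Finset.expect_nonneg fun _ _ => abs_nonneg _) (fun n => ?_) herr
  refine (Finset.expect_le_expect fun ω _ => abs_final_sub_limit_le hb0 (j n) ω _).trans ?_
  rw [Finset.expect_add_distrib, Finset.expect_add_distrib, ← Finset.mul_expect,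
    Fintype.expect_const, ← Finset.expect_div, ← Finset.expect_div]
  have hN : (0 : ℝ) < (n : ℝ) + 1 := by positivity
  have hs : √((n : ℝ) + 1) / ((n : ℝ) + 1) = √(1 / ((n : ℝ) + 1)) := by
    rw [Real.sqrt_div_self', Real.sqrt_div zero_le_one, Real.sqrt_one]
  have e1 := div_le_div_of_nonneg_right (expect_abs_final_sub_predicted_le (j n)) hN.le
  have e2 := div_le_div_of_nonneg_right (expect_abs_clearTime_sub_le (j n)) hN.le
  rw [mul_div_assoc, hs] at e1
  rw [add_div, mul_div_assoc, hs] at e2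
  have e3 : 2 / ((n : ℝ) + 1) = 2 * (1 / ((n : ℝ) + 1)) := by ring
  have e4 : 4 / ((n : ℝ) + 1) = 4 * (1 / ((n : ℝ) + 1)) := by ring
  rw [e4] at e2
  rw [e3]
  simp only [cardPosition]
  linarith

/-! ### Monotonicity and range of the limit map -/

theorem limitPosition_eq (b u : ℝ) :
    limitPosition b u =
      exp (min ((1 - u) * exp (-b)) (1 - b)) - exp 1 * ((1 - u) * exp (-b)) := by
  have : exp (1 - b) = exp 1 * exp (-b) := by rw [← exp_add]; ring_nf
  rw [limitPosition, this]
  ring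

theorem continuous_limitPosition (b : ℝ) : Continuous (limitPosition b) := by
  unfold limitPosition
  fun_prop

/-- In w = (1 - u) exp(-b) the map is exp(min(w, 1 - b)) - e w. Since the exponent is at most 1, the
first term grows strictly more slowly than e w. -/
theorem limitPosition_strictMono {b : ℝ} (hb : 0 ≤ b) : StrictMono (limitPosition b) := by
  intro u v huv
  rw [limitPosition_eq, limitPosition_eq]
  have hw : (1 - v) * exp (-b) < (1 - u) * exp (-b) :=
    mul_lt_mul_of_pos_right (by linarith) (exp_pos _)
  set w := (1 - u) * exp (-b)
  set w' := (1 - v) * exp (-b)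
  have h1 : min w' (1 - b) ≤ min w (1 - b) := min_le_min_right _ hw.le
  have h2 : min w (1 - b) - min w' (1 - b) ≤ w - w' := by
    rcases min_cases w (1 - b) with h | h <;> rcases min_cases w' (1 - b) with h' | h' <;> linarith
  have h3 : exp (min w (1 - b)) ≤ exp 1 := exp_le_exp.2 ((min_le_right _ _).trans (by linarith))
  rcases h1.eq_or_lt with h | h
  · rw [h]
    have := mul_lt_mul_of_pos_left hw (exp_pos 1)
    linarith
  · have h4 := Real.add_one_lt_exp (x := min w' (1 - b) - min w (1 - b)) (by linarith)
    have h5 : exp (min w' (1 - b)) =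
        exp (min w (1 - b)) * exp (min w' (1 - b) - min w (1 - b)) := by
      rw [← exp_add]; congr 1; ring
    have h6 := exp_pos (min w (1 - b))
    have h7 := mul_lt_mul_of_pos_left h4 h6
    have h8 := mul_le_mul h3 h2 (by linarith) (exp_pos 1).le
    nlinarith

theorem limitPosition_zero {b : ℝ} : limitPosition b 0 = 0 := by
  have : 1 - b ≤ exp (-b) := by linarith [Real.add_one_le_exp (-b)]
  simp [limitPosition, min_eq_right this]

theorem limitPosition_one {b : ℝ} (hb : b ≤ 1) : limitPosition b 1 = 1 := by
  simp [limitPosition, min_eq_left (sub_nonneg.2 hb)]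

theorem exists_limitPosition_eq {b x : ℝ} (hb : b ≤ 1) (hx : x ∈ Icc (0 : ℝ) 1) :
    ∃ u ∈ Icc (0 : ℝ) 1, limitPosition b u = x := by
  have := intermediate_value_Icc zero_le_one (continuous_limitPosition b).continuousOn
  rw [limitPosition_zero, limitPosition_one hb] at this
  exact this hx

/-! ### Convergence of the distribution function and of the mean -/

/-- Riemann sums of a monotone function. -/
theorem tendsto_expect_of_monotoneOn {G : ℝ → ℝ} (hG : MonotoneOn G (Icc 0 1)) :
    Tendsto (fun n : ℕ => 𝔼 k : Fin (n + 1), G ((k : ℕ) / ((n : ℝ) + 1))) atTop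
      (𝓝 (∫ u in (0 : ℝ)..1, G u)) := by
  have hinv : Tendsto (fun n : ℕ => 1 / ((n : ℝ) + 1)) atTop (𝓝 0) :=
    tendsto_one_div_add_atTop_nhds_zero_nat
  have key : ∀ n : ℕ, 𝔼 k : Fin (n + 1), G ((k : ℕ) / ((n : ℝ) + 1)) ≤ ∫ u in (0 : ℝ)..1, G u ∧
      (∫ u in (0 : ℝ)..1, G u) - (G 1 - G 0) * (1 / ((n : ℝ) + 1)) ≤
        𝔼 k : Fin (n + 1), G ((k : ℕ) / ((n : ℝ) + 1)) := by
    intro n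
    have hN : (0 : ℝ) < (n : ℝ) + 1 := by positivity
    have hmono : MonotoneOn (fun x => G (x / ((n : ℝ) + 1))) (Icc 0 (0 + ((n + 1 : ℕ) : ℝ))) := by
      intro x hx y hy hxy
      have hmem : ∀ z ∈ Icc 0 (0 + ((n + 1 : ℕ) : ℝ)), z / ((n : ℝ) + 1) ∈ Icc (0 : ℝ) 1 := by
        intro z hz
        push_cast at hz
        exact ⟨div_nonneg hz.1 hN.le, (div_le_one hN).2 (by linarith [hz.2])⟩
      exact hG (hmem x hx) (hmem y hy) (div_le_div_of_nonneg_right hxy hN.le)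
    have h1 := hmono.sum_le_integral
    have h2 := hmono.integral_le_sum
    have e : ∫ x in (0 : ℝ)..(0 + ((n + 1 : ℕ) : ℝ)), G (x / ((n : ℝ) + 1)) =
        ((n : ℝ) + 1) * ∫ u in (0 : ℝ)..1, G u := by
      rw [intervalIntegral.integral_comp_div (f := G) hN.ne', smul_eq_mul]
      congr 2
      · simp
      · push_cast; field_simp; ring
    rw [e] at h1 h2
    simp only [zero_add] at h1 h2
    have h3 := Finset.sum_range_succ' (fun i : ℕ => G ((i : ℝ) / ((n : ℝ) + 1))) (n + 1)
    rw [Finset.sum_range_succ] at h3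
    have h4 : G (((n + 1 : ℕ) : ℝ) / ((n : ℝ) + 1)) = G 1 := by
      push_cast; rw [div_self hN.ne']
    have h5 : G (((0 : ℕ) : ℝ) / ((n : ℝ) + 1)) = G 0 := by simp
    rw [h4, h5] at h3
    rw [Fintype.expect_eq_sum_div_card, Fintype.card_fin,
      Fin.sum_univ_eq_sum_range (fun i => G ((i : ℝ) / ((n : ℝ) + 1)))]
    push_cast at *
    constructor
    · rw [div_le_iff₀ hN]; linarith
    · rw [le_div_iff₀ hN, sub_mul, mul_assoc, one_div_mul_cancel hN.ne']; linarith
  have hlow := (hinv.const_mul (G 1 - G 0)).const_sub (∫ u in (0 : ℝ)..1, G u)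
  rw [mul_zero, sub_zero] at hlow
  exact tendsto_of_tendsto_of_tendsto_of_le_of_le hlow tendsto_const_nhds
    (fun n => (key n).2) (fun n => (key n).1)

theorem expect_apply_coord {n : ℕ} (j : Fin (n + 1)) (G : Fin (n + 1) → ℝ) :
    𝔼 ω : Fin (n + 1) → Fin (n + 1), G (ω j) = 𝔼 k, G k := by
  rw [expect_update j]
  simp

theorem tendsto_expect_le_indicator {v : ℝ} (hv0 : 0 ≤ v) (hv1 : v < 1) :
    Tendsto (fun n : ℕ => 𝔼 k : Fin (n + 1), if ((k : ℕ) : ℝ) / ((n : ℝ) + 1) ≤ v then (1 : ℝ) else 0)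
      atTop (𝓝 v) := by
  have hinv : Tendsto (fun n : ℕ => 1 / ((n : ℝ) + 1)) atTop (𝓝 0) :=
    tendsto_one_div_add_atTop_nhds_zero_nat
  have h := ((tendsto_nat_floor_mul_div_atTop hv0).comp
    ((tendsto_natCast_atTop_atTop (R := ℝ)).comp (tendsto_add_atTop_nat 1))).add hinv
  rw [add_zero] at h
  refine h.congr fun n => ?_
  have hN : (0 : ℝ) < (n : ℝ) + 1 := by positivity
  have hm : ⌊v * ((n : ℝ) + 1)⌋₊ + 1 ≤ n + 1 := by
    rw [Nat.succ_le_iff, Nat.floor_lt (by positivity)]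
    push_cast
    nlinarith
  have := expect_lt_indicator hm
  simp only [Nat.lt_succ_iff, Nat.le_floor_iff (mul_nonneg hv0 hN.le)] at this
  simp only [div_le_iff₀ hN, this]
  simp [add_div]

theorem positionCDF_eq_expect (n : ℕ) (j : Fin (n + 1)) (x : ℝ) :
    positionCDF n j x = 𝔼 ω : Fin (n + 1) → Fin (n + 1),
      if cardPosition (deck ω (n + 1)) j / ((n : ℝ) + 1) ≤ x then (1 : ℝ) else 0 := by
  classical
  have hN : (0 : ℝ) < (n : ℝ) + 1 := by positivity
  unfold positionCDF shuffleLaw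
  rw [PMF.toOuterMeasure_map_apply, PMF.toOuterMeasure_uniformOfFintype_apply,
    Fintype.expect_eq_sum_div_card, Finset.sum_boole, ENNReal.toReal_div]
  simp only [ENNReal.toReal_natCast]
  congr 2
  rw [Fintype.card_subtype]
  simp [cyclicInsertion_eq_deck, div_le_iff₀ hN]

theorem meanPosition_eq_expect (n : ℕ) (j : Fin (n + 1)) :
    meanPosition n j = 𝔼 ω : Fin (n + 1) → Fin (n + 1), cardPosition (deck ω (n + 1)) j := by
  classical
  unfold meanPosition shuffleLaw
  have h : ∀ σ, ((PMF.uniformOfFintype (Fin (n + 1) → Fin (n + 1))).map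
      (cyclicInsertion n) σ).toReal = 𝔼 ω : Fin (n + 1) → Fin (n + 1),
        if σ = deck ω (n + 1) then (1 : ℝ) else 0 := by
    intro σ
    rw [PMF.map_apply, tsum_fintype, ENNReal.toReal_sum]
    · rw [Fintype.expect_eq_sum_div_card, Finset.sum_div]
      refine Finset.sum_congr rfl fun ω _ => ?_
      rw [cyclicInsertion_eq_deck]
      rw [PMF.uniformOfFintype_apply]
      split_ifs
      · rw [ENNReal.toReal_inv, ENNReal.toReal_natCast, one_div]
      · simp
    · intro ω _
      split_ifs
      · exact PMF.apply_ne_top _ _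
      · simp
  simp only [h, Finset.expect_mul]
  rw [← Finset.expect_sum_comm]
  simp

/-- A Markov inequality: for v ≠ u, the events "rescaled position ≤ L_b(u)" and U ≤ v can disagree
in the harmful direction only if the L¹-small error is at least |L_b(u) - L_b(v)|. Then v tends to
u. -/
theorem tendsto_positionCDF {b : ℝ} (hb : b ∈ Icc (0 : ℝ) 1) {j : (n : ℕ) → Fin (n + 1)}
    (hj : IsCardSequence b j) {u : ℝ} (hu : u ∈ Icc (0 : ℝ) 1) :
    Tendsto (fun n : ℕ => positionCDF n (j n) (limitPosition b u)) atTop (𝓝 u) := by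
  have herr := tendsto_expect_abs_sub_limitPosition hb.1 hj
  have hmono := limitPosition_strictMono hb.1
  refine tendsto_order.2 ⟨fun a ha => ?_, fun a ha => ?_⟩
  · rcases lt_or_ge a 0 with ha0 | ha0
    · refine Eventually.of_forall fun n => ha0.trans_le ?_
      rw [positionCDF_eq_expect]
      exact Finset.expect_nonneg fun _ _ => by split_ifs <;> norm_num
    obtain ⟨v, hav, hvu⟩ := exists_between ha
    have hε : 0 < limitPosition b u - limitPosition b v := sub_pos.2 (hmono hvu)
    have hlim := (tendsto_expect_le_indicator (by linarith) (hvu.trans_le hu.2)).sub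
      (herr.div_const (limitPosition b u - limitPosition b v))
    rw [zero_div, sub_zero] at hlim
    filter_upwards [hlim.eventually (lt_mem_nhds hav)] with n hn
    refine hn.trans_le ?_
    rw [positionCDF_eq_expect, ← expect_apply_coord (j n), Finset.expect_div,
      ← Finset.expect_sub_distrib]
    refine Finset.expect_le_expect fun ω _ => ?_
    set Y := cardPosition (deck ω (n + 1)) (j n) / ((n : ℝ) + 1)
    set U := ((ω (j n) : ℕ) : ℝ) / ((n : ℝ) + 1)
    have h0 : 0 ≤ |Y - limitPosition b U| / (limitPosition b u - limitPosition b v) := by positivity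
    by_cases hU : U ≤ v
    · by_cases hY : Y ≤ limitPosition b u
      · rw [if_pos hU, if_pos hY]; linarith
      · rw [if_pos hU, if_neg hY]
        have h1 := hmono.monotone hU
        have : 1 ≤ |Y - limitPosition b U| / (limitPosition b u - limitPosition b v) := by
          rw [one_le_div hε]
          linarith [le_abs_self (Y - limitPosition b U)]
        linarith
    · rw [if_neg hU]
      split_ifs <;> linarith
  · rcases lt_or_ge 1 a with ha1 | ha1
    · refine Eventually.of_forall fun n => lt_of_le_of_lt ?_ ha1
      rw [positionCDF_eq_expect]
      exact Finset.expect_le Finset.univ_nonempty fun _ _ => by split_ifs <;> norm_num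
    obtain ⟨v, huv, hva⟩ := exists_between ha
    have hε : 0 < limitPosition b v - limitPosition b u := sub_pos.2 (hmono huv)
    have hlim := (tendsto_expect_le_indicator (hu.1.trans huv.le) (hva.trans_le ha1)).add
      (herr.div_const (limitPosition b v - limitPosition b u))
    rw [zero_div, add_zero] at hlim
    filter_upwards [hlim.eventually (gt_mem_nhds hva)] with n hn
    refine lt_of_le_of_lt ?_ hn
    rw [positionCDF_eq_expect, ← expect_apply_coord (j n), Finset.expect_div,
      ← Finset.expect_add_distrib]
    refine Finset.expect_le_expect fun ω _ => ?_
    set Y := cardPosition (deck ω (n + 1)) (j n) / ((n : ℝ) + 1)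
    set U := ((ω (j n) : ℕ) : ℝ) / ((n : ℝ) + 1)
    have h0 : 0 ≤ |Y - limitPosition b U| / (limitPosition b v - limitPosition b u) := by positivity
    by_cases hU : U ≤ v
    · rw [if_pos hU]
      split_ifs <;> linarith
    · rw [if_neg hU]
      by_cases hY : Y ≤ limitPosition b u
      · rw [if_pos hY]
        have h1 := hmono.monotone (le_of_not_ge hU)
        have : 1 ≤ |Y - limitPosition b U| / (limitPosition b v - limitPosition b u) := by
          rw [one_le_div hε]
          linarith [neg_le_abs (Y - limitPosition b U)]
        linarith
      · rw [if_neg hY]; linarith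

theorem tendsto_meanPosition {b : ℝ} (hb : b ∈ Icc (0 : ℝ) 1) :
    IsLimitMean b (∫ u in (0 : ℝ)..1, limitPosition b u) := by
  intro j hj
  have herr := tendsto_expect_abs_sub_limitPosition hb.1 hj
  have hlim := tendsto_expect_of_monotoneOn
    ((limitPosition_strictMono hb.1).monotone.monotoneOn (Icc 0 1))
  have hdiff : Tendsto (fun n : ℕ => meanPosition n (j n) / ((n : ℝ) + 1) -
      𝔼 k : Fin (n + 1), limitPosition b ((k : ℕ) / ((n : ℝ) + 1))) atTop (𝓝 0) := by
    refine squeeze_zero_norm (fun n => ?_) herr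
    rw [meanPosition_eq_expect, Finset.expect_div,
      ← expect_apply_coord (j n) (fun k => limitPosition b ((k : ℕ) / ((n : ℝ) + 1))),
      ← Finset.expect_sub_distrib, Real.norm_eq_abs]
    exact Finset.abs_expect_le _ _
  simpa using hdiff.add hlim

/-- Without such a sequence the definitions of limit density and limit mean would be vacuous and
would determine nothing. -/
theorem exists_isCardSequence {b : ℝ} (hb : b ∈ Icc (0 : ℝ) 1) :
    ∃ j : (n : ℕ) → Fin (n + 1), IsCardSequence b j := by
  have hle : ∀ n : ℕ, ⌊b * n⌋₊ < n + 1 := by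
    intro n
    rw [Nat.lt_succ_iff]
    exact Nat.floor_le_of_le (mul_le_of_le_one_left (Nat.cast_nonneg n) hb.2)
  refine ⟨fun n => ⟨⌊b * n⌋₊, hle n⟩, ?_⟩
  have h1 := (tendsto_nat_floor_mul_div_atTop hb.1).comp (tendsto_natCast_atTop_atTop (R := ℝ))
  have h2 := tendsto_natCast_div_add_atTop (1 : ℝ)
  have h3 : Tendsto (fun n : ℕ => 1 / ((n : ℝ) + 1)) atTop (𝓝 0) :=
    tendsto_one_div_add_atTop_nhds_zero_nat
  have h4 := (h1.mul h2).add h3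
  rw [mul_one, add_zero] at h4
  refine h4.congr' ?_
  filter_upwards [eventually_gt_atTop 0] with n hn
  have : (0 : ℝ) < n := by exact_mod_cast hn
  simp only [Function.comp]
  field_simp

/-! ### The limit law, its density and uniqueness -/

/-- The law of the limiting rescaled final position. -/
noncomputable def limitLaw (b : ℝ) : Measure ℝ :=
  (volume.restrict (Icc 0 1)).map (limitPosition b)

theorem measurable_limitPosition (b : ℝ) : Measurable (limitPosition b) :=
  (continuous_limitPosition b).measurable

instance isProbabilityMeasure_volume_restrict_Icc :
    IsProbabilityMeasure ((volume : Measure ℝ).restrict (Icc 0 1)) :=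
  ⟨by simp⟩

instance isProbabilityMeasure_limitLaw (b : ℝ) : IsProbabilityMeasure (limitLaw b) :=
  Measure.isProbabilityMeasure_map (measurable_limitPosition b).aemeasurable

theorem limitLaw_Iic {b u : ℝ} (hb : 0 ≤ b) (hu : u ∈ Icc (0 : ℝ) 1) :
    limitLaw b (Iic (limitPosition b u)) = ENNReal.ofReal u := by
  have h : limitPosition b ⁻¹' Iic (limitPosition b u) = Iic u := by
    ext v
    exact (limitPosition_strictMono hb).le_iff_le
  rw [limitLaw, Measure.map_apply (measurable_limitPosition b) measurableSet_Iic, h,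
    Measure.restrict_apply measurableSet_Iic]
  have : Iic u ∩ Icc 0 1 = Icc 0 u := by
    ext v
    simp only [mem_inter_iff, mem_Iic, mem_Icc]
    exact ⟨fun h => ⟨h.2.1, h.1⟩, fun h => ⟨h.2, h.1, h.2.trans hu.2⟩⟩
  rw [this]
  simp

theorem hasDerivAt_limitPosition_pos {b u : ℝ} (hb : 0 ≤ b) (hu : (1 - u) * exp (-b) ≠ 1 - b) :
    ∃ d > 0, HasDerivAt (limitPosition b) d u := by
  have hlin : HasDerivAt (fun u : ℝ => (1 - u) * exp (1 - b)) (-exp (1 - b)) u := by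
    simpa using ((hasDerivAt_id u).const_sub 1).mul_const (exp (1 - b))
  have hw : HasDerivAt (fun u : ℝ => (1 - u) * exp (-b)) (-exp (-b)) u := by
    simpa using ((hasDerivAt_id u).const_sub 1).mul_const (exp (-b))
  have hcont : Continuous fun u : ℝ => (1 - u) * exp (-b) := by fun_prop
  rcases lt_or_gt_of_ne hu with h | h
  · refine ⟨exp ((1 - u) * exp (-b)) * -exp (-b) - -exp (1 - b), ?_, ?_⟩
    · have : exp (1 - b) = exp 1 * exp (-b) := by rw [← exp_add]; ring_nf
      have h1 : exp ((1 - u) * exp (-b)) < exp 1 := exp_lt_exp.2 (by linarith)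
      have := mul_lt_mul_of_pos_right h1 (exp_pos (-b))
      linarith
    · refine (hw.exp.sub hlin).congr_of_eventuallyEq ?_
      filter_upwards [hcont.continuousAt.eventually (gt_mem_nhds h)] with v hv
      simp [limitPosition, min_eq_left hv.le]
  · refine ⟨0 - -exp (1 - b), by simp [exp_pos], ?_⟩
    refine ((hasDerivAt_const u (exp (1 - b))).sub hlin).congr_of_eventuallyEq ?_
    filter_upwards [hcont.continuousAt.eventually (lt_mem_nhds h)] with v hv
    simp [limitPosition, min_eq_right (le_of_lt (show 1 - b < (1 - v) * exp (-b) from hv))]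

/-- Off the single kink `u₀`, where the two arguments of the minimum coincide, the limit map has
positive derivative; by the change of variables formula the preimage of a null set is null. -/
theorem limitLaw_absolutelyContinuous {b : ℝ} (hb : 0 ≤ b) :
    limitLaw b ≪ (volume : Measure ℝ) := by
  refine Measure.AbsolutelyContinuous.mk fun N hN hN0 => ?_
  let u₀ : ℝ := 1 - (1 - b) * exp b
  have hne : ∀ u ∈ ({u₀}ᶜ : Set ℝ), (1 - u) * exp (-b) ≠ 1 - b := by
    intro u hu h
    apply hu
    have : (1 - u) = (1 - b) * exp b := by
      rw [← h, mul_assoc, ← exp_add]; simp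
    simp only [mem_singleton_iff, u₀]
    linarith
  have hd : ∀ u ∈ ({u₀}ᶜ : Set ℝ), 0 < deriv (limitPosition b) u ∧
      HasDerivAt (limitPosition b) (deriv (limitPosition b) u) u := by
    intro u hu
    obtain ⟨d, hd0, hd⟩ := hasDerivAt_limitPosition_pos hb (hne u hu)
    rw [hd.deriv]
    exact ⟨hd0, hd⟩
  have hmeas : MeasurableSet ({u₀}ᶜ ∩ limitPosition b ⁻¹' N : Set ℝ) :=
    (measurableSet_singleton _).compl.inter (measurable_limitPosition b hN)
  have h := lintegral_image_eq_lintegral_abs_deriv_mul hmeas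
    (fun u hu => (hd u hu.1).2.hasDerivWithinAt) (limitPosition_strictMono hb).injective.injOn
    (fun _ => 1)
  have hzero : volume (limitPosition b '' ({u₀}ᶜ ∩ limitPosition b ⁻¹' N)) = 0 := by
    refine measure_mono_null ?_ hN0
    rintro _ ⟨u, hu, rfl⟩
    exact hu.2
  rw [setLIntegral_one, hzero] at h
  have hnull : volume ({u₀}ᶜ ∩ limitPosition b ⁻¹' N : Set ℝ) = 0 := by
    have hm : Measurable fun u => ENNReal.ofReal |deriv (limitPosition b) u| * 1 := by
      have := measurable_deriv (limitPosition b)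
      fun_prop
    have h' := (setLIntegral_eq_zero_iff hmeas hm).1 h.symm
    refine measure_mono_null (fun u hu => ?_) (ae_iff.1 h')
    have := (hd u hu.1).1
    simpa [this.ne'] using hu
  rw [limitLaw, Measure.map_apply (measurable_limitPosition b) hN]
  refine Measure.absolutelyContinuous_of_le Measure.restrict_le_self ?_
  have hsub : limitPosition b ⁻¹' N ⊆ ({u₀}ᶜ ∩ limitPosition b ⁻¹' N) ∪ {u₀} := by
    intro u hu
    by_cases h : u = u₀
    · exact Or.inr h
    · exact Or.inl ⟨h, hu⟩
  exact measure_mono_null hsub (measure_union_null hnull (by simp))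

theorem withDensity_rnDeriv_limitLaw {b : ℝ} (hb : 0 ≤ b) :
    (volume : Measure ℝ).withDensity ((limitLaw b).rnDeriv volume) = limitLaw b :=
  Measure.withDensity_rnDeriv_eq _ _ (limitLaw_absolutelyContinuous hb)

theorem isLimitDensity_rnDeriv {b : ℝ} (hb : b ∈ Icc (0 : ℝ) 1) :
    IsLimitDensity b ((limitLaw b).rnDeriv volume) where
  measurable := Measure.measurable_rnDeriv _ _
  lintegral_eq_one := by
    rw [← setLIntegral_univ, ← withDensity_apply _ MeasurableSet.univ,
      withDensity_rnDeriv_limitLaw hb.1, measure_univ]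
  tendsto_cdf := by
    intro j hj x hx
    obtain ⟨u, hu, rfl⟩ := exists_limitPosition_eq hb.2 hx
    rw [← withDensity_apply _ measurableSet_Iic, withDensity_rnDeriv_limitLaw hb.1,
      limitLaw_Iic hb.1 hu, ENNReal.toReal_ofReal hu.1]
    exact tendsto_positionCDF hb hj hu

/-- The hypothesis fixes the distribution function only on [0,1]; the values 0 at 0 and 1 at 1, with
total mass one, force the rest. -/
theorem IsLimitDensity.withDensity_eq {b : ℝ} (hb : b ∈ Icc (0 : ℝ) 1) {f : ℝ → ℝ≥0∞}
    (hf : IsLimitDensity b f) : (volume : Measure ℝ).withDensity f = limitLaw b := by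
  have hprob : IsProbabilityMeasure ((volume : Measure ℝ).withDensity f) :=
    ⟨by rw [withDensity_apply _ MeasurableSet.univ, setLIntegral_univ, hf.lintegral_eq_one]⟩
  have key : ∀ x ∈ Icc (0 : ℝ) 1, (volume : Measure ℝ).withDensity f (Iic x) = limitLaw b (Iic x) := by
    intro x hx
    obtain ⟨j, hj⟩ := exists_isCardSequence hb
    have h := hf.tendsto_cdf j hj x hx
    rw [← withDensity_apply _ measurableSet_Iic] at h
    obtain ⟨u, hu, rfl⟩ := exists_limitPosition_eq hb.2 hx
    have := tendsto_nhds_unique h (tendsto_positionCDF hb hj hu)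
    rw [limitLaw_Iic hb.1 hu]
    nth_rewrite 2 [← this]
    rw [ENNReal.ofReal_toReal (measure_ne_top _ _)]
  have h0 : limitLaw b (Iic 0) = 0 := by
    have := limitLaw_Iic hb.1 (u := 0) ⟨le_rfl, zero_le_one⟩
    simpa [limitPosition_zero] using this
  have h1 : limitLaw b (Iic 1) = 1 := by
    have := limitLaw_Iic hb.1 (u := 1) ⟨zero_le_one, le_rfl⟩
    simpa [limitPosition_one hb.2] using this
  refine Measure.ext_of_Iic _ _ fun x => ?_
  rcases lt_or_ge x 0 with hx0 | hx0
  · rw [measure_mono_null (Iic_subset_Iic.2 hx0.le) h0,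
      measure_mono_null (Iic_subset_Iic.2 hx0.le) ((key 0 ⟨le_rfl, zero_le_one⟩).trans h0)]
  rcases lt_or_ge 1 x with hx1 | hx1
  · have e : ∀ μ : Measure ℝ, IsProbabilityMeasure μ → μ (Iic 1) = 1 → μ (Iic x) = 1 :=
      fun μ _ h => le_antisymm prob_le_one (h ▸ measure_mono (Iic_subset_Iic.2 hx1.le))
    rw [e _ inferInstance h1, e _ hprob ((key 1 ⟨zero_le_one, le_rfl⟩).trans h1)]
  · exact key x ⟨hx0, hx1⟩

theorem IsLimitMean.eq_integral {b m : ℝ} (hb : b ∈ Icc (0 : ℝ) 1) (hm : IsLimitMean b m) :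
    m = ∫ u in (0 : ℝ)..1, limitPosition b u := by
  obtain ⟨j, hj⟩ := exists_isCardSequence hb
  exact tendsto_nhds_unique (hm j hj) (tendsto_meanPosition hb j hj)

/-! ### Comparison probabilities as areas in the unit square -/

theorem probLeft_eq {b₁ b₂ : ℝ} (hb₁ : b₁ ∈ Icc (0 : ℝ) 1) (hb₂ : b₂ ∈ Icc (0 : ℝ) 1)
    {f g : ℝ → ℝ≥0∞} (hf : IsLimitDensity b₁ f) (hg : IsLimitDensity b₂ g) :
    probLeft f g = ((((volume : Measure ℝ).restrict (Icc 0 1)).prod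
      ((volume : Measure ℝ).restrict (Icc 0 1)))
      {z | limitPosition b₁ z.1 < limitPosition b₂ z.2}).toReal := by
  rw [probLeft, Measure.volume_eq_prod, ← prod_withDensity hf.measurable hg.measurable,
    hf.withDensity_eq hb₁, hg.withDensity_eq hb₂, limitLaw, limitLaw,
    Measure.map_prod_map _ _ (measurable_limitPosition b₁) (measurable_limitPosition b₂),
    Measure.map_apply ((measurable_limitPosition b₁).prodMap (measurable_limitPosition b₂))
      (measurableSet_lt measurable_fst measurable_snd)]
  rfl

theorem measurableSet_limitPosition_lt (b₁ b₂ : ℝ) :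
    MeasurableSet {z : ℝ × ℝ | limitPosition b₁ z.1 < limitPosition b₂ z.2} :=
  measurableSet_lt ((measurable_limitPosition b₁).comp measurable_fst)
    ((measurable_limitPosition b₂).comp measurable_snd)

theorem setLIntegral_ofReal_Icc {φ : ℝ → ℝ} (hφ : IntervalIntegrable φ volume 0 1)
    (h0 : ∀ v ∈ Icc (0 : ℝ) 1, 0 ≤ φ v) :
    ∫⁻ v in Icc (0 : ℝ) 1, ENNReal.ofReal (φ v) = ENNReal.ofReal (∫ v in (0 : ℝ)..1, φ v) := by
  rw [intervalIntegral.integral_of_le zero_le_one, ← integral_Icc_eq_integral_Ioc,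
    ofReal_integral_eq_lintegral_ofReal]
  · rw [← IntegrableOn, integrableOn_Icc_iff_integrableOn_Ioc]
    exact (intervalIntegrable_iff_integrableOn_Ioc_of_le zero_le_one).1 hφ
  · exact (ae_restrict_iff' measurableSet_Icc).2 (ae_of_all _ h0)

theorem volume_restrict_Icc_Iio {x : ℝ} (hx : x ∈ Icc (0 : ℝ) 1) :
    (volume : Measure ℝ).restrict (Icc 0 1) (Iio x) = ENNReal.ofReal x := by
  rw [Measure.restrict_apply measurableSet_Iio]
  have : Iio x ∩ Icc 0 1 = Ico 0 x := by
    ext y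
    simp only [mem_inter_iff, mem_Iio, mem_Icc, mem_Ico]
    exact ⟨fun h => ⟨h.2.1, h.1⟩, fun h => ⟨h.2, h.1, h.2.le.trans hx.2⟩⟩
  rw [this]
  simp

/-- By monotonicity the slice at height v contains all u < φ v. Only an inequality is needed, so the
inverse of the limit map never has to be computed. -/
theorem integral_le_probLeft {b₁ b₂ : ℝ} (hb₁ : b₁ ∈ Icc (0 : ℝ) 1) (hb₂ : b₂ ∈ Icc (0 : ℝ) 1)
    {f g : ℝ → ℝ≥0∞} (hf : IsLimitDensity b₁ f) (hg : IsLimitDensity b₂ g)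
    {φ : ℝ → ℝ} (hφ : IntervalIntegrable φ volume 0 1)
    (hmem : ∀ v ∈ Icc (0 : ℝ) 1, φ v ∈ Icc (0 : ℝ) 1)
    (hle : ∀ v ∈ Icc (0 : ℝ) 1, limitPosition b₁ (φ v) ≤ limitPosition b₂ v) :
    ∫ v in (0 : ℝ)..1, φ v ≤ probLeft f g := by
  rw [probLeft_eq hb₁ hb₂ hf hg]
  refine (ENNReal.ofReal_le_iff_le_toReal (measure_ne_top _ _)).1 ?_
  rw [← setLIntegral_ofReal_Icc hφ fun v hv => (hmem v hv).1,
    Measure.prod_apply_symm (measurableSet_limitPosition_lt b₁ b₂)]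
  refine setLIntegral_mono' measurableSet_Icc fun v hv => ?_
  rw [← volume_restrict_Icc_Iio (hmem v hv)]
  exact measure_mono fun u hu => (limitPosition_strictMono hb₁.1 hu).trans_le (hle v hv)

theorem probLeft_le_integral {b₁ b₂ : ℝ} (hb₁ : b₁ ∈ Icc (0 : ℝ) 1) (hb₂ : b₂ ∈ Icc (0 : ℝ) 1)
    {f g : ℝ → ℝ≥0∞} (hf : IsLimitDensity b₁ f) (hg : IsLimitDensity b₂ g)
    {φ : ℝ → ℝ} (hφ : IntervalIntegrable φ volume 0 1)
    (hmem : ∀ v ∈ Icc (0 : ℝ) 1, φ v ∈ Icc (0 : ℝ) 1)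
    (hle : ∀ v ∈ Icc (0 : ℝ) 1, limitPosition b₂ v ≤ limitPosition b₁ (φ v)) :
    probLeft f g ≤ ∫ v in (0 : ℝ)..1, φ v := by
  rw [probLeft_eq hb₁ hb₂ hf hg]
  refine ENNReal.toReal_le_of_le_ofReal
    (intervalIntegral.integral_nonneg zero_le_one fun v hv => (hmem v hv).1) ?_
  rw [← setLIntegral_ofReal_Icc hφ fun v hv => (hmem v hv).1,
    Measure.prod_apply_symm (measurableSet_limitPosition_lt b₁ b₂)]
  refine setLIntegral_mono' measurableSet_Icc fun v hv => ?_
  rw [← volume_restrict_Icc_Iio (hmem v hv)]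
  exact measure_mono fun u hu =>
    (limitPosition_strictMono hb₁.1).lt_iff_lt.1 (lt_of_lt_of_le hu (hle v hv))

theorem limitPosition_one_left (v : ℝ) (hv : v ≤ 1) : limitPosition 1 v = v := by
  have : (0 : ℝ) ≤ (1 - v) * exp (-1) := mul_nonneg (by linarith) (exp_pos _).le
  simp [limitPosition, min_eq_right this]

/-- Against a uniform position the comparison is decided by the mean. -/
theorem probLeft_one_eq {b : ℝ} (hb : b ∈ Icc (0 : ℝ) 1) {f g : ℝ → ℝ≥0∞}
    (hf : IsLimitDensity b f) (hg : IsLimitDensity 1 g) :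
    probLeft f g = 1 - ∫ u in (0 : ℝ)..1, limitPosition b u := by
  have hmono := (limitPosition_strictMono hb.1).monotone
  have hint : IntervalIntegrable (limitPosition b) volume 0 1 :=
    (continuous_limitPosition b).intervalIntegrable 0 1
  have hmem : ∀ u ∈ Icc (0 : ℝ) 1, limitPosition b u ∈ Icc (0 : ℝ) 1 := fun u hu =>
    ⟨limitPosition_zero (b := b) ▸ hmono hu.1, limitPosition_one hb.2 ▸ hmono hu.2⟩
  have hone : 1 - ∫ u in (0 : ℝ)..1, limitPosition b u =
      ∫ u in (0 : ℝ)..1, (1 - limitPosition b u) := by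
    rw [intervalIntegral.integral_sub (by simp) hint]
    simp
  rw [probLeft_eq hb ⟨zero_le_one, le_rfl⟩ hf hg, hone,
    Measure.prod_apply (measurableSet_limitPosition_lt b 1)]
  have hnn : ∀ u ∈ Icc (0 : ℝ) 1, 0 ≤ 1 - limitPosition b u := fun u hu =>
    sub_nonneg.2 (hmem u hu).2
  rw [← ENNReal.toReal_ofReal (intervalIntegral.integral_nonneg zero_le_one hnn),
    ← setLIntegral_ofReal_Icc ((by simp : IntervalIntegrable (fun _ => (1 : ℝ)) volume 0 1).sub hint)
      hnn]
  congr 1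
  refine setLIntegral_congr_fun measurableSet_Icc fun u hu => ?_
  have hset : (Prod.mk u ⁻¹' {z : ℝ × ℝ | limitPosition b z.1 < limitPosition 1 z.2}) ∩ Icc 0 1 =
      Ioc (limitPosition b u) 1 := by
    ext v
    simp only [mem_inter_iff, mem_preimage, Set.mem_ofPred_eq, mem_Icc, mem_Ioc]
    constructor
    · rintro ⟨h1, h2⟩
      rw [limitPosition_one_left v h2.2] at h1
      exact ⟨h1, h2.2⟩
    · rintro ⟨h1, h2⟩
      exact ⟨by rwa [limitPosition_one_left v h2], (hmem u hu).1.trans h1.le, h2⟩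
  rw [Measure.restrict_apply' measurableSet_Icc, hset, Real.volume_Ioc]

/-! ### The kink of the limit map and its mean -/

/-- The limiting rescaled position, just before its removal, of a card with a number around `b` times
the size of the deck. -/
noncomputable def frontPosition (b : ℝ) : ℝ := 1 - (1 - b) * exp b

theorem frontPosition_strictMonoOn : StrictMonoOn frontPosition (Icc 0 1) := by
  have hd : ∀ b, HasDerivAt frontPosition (b * exp b) b := by
    intro b
    have := ((((hasDerivAt_id b).const_sub 1).mul (Real.hasDerivAt_exp b)).const_sub 1)
    refine this.congr_deriv ?_
    simp only [id]
    ring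
  refine strictMonoOn_of_deriv_pos (convex_Icc 0 1)
    (fun b _ => (hd b).continuousAt.continuousWithinAt) fun b hb => ?_
  rw [interior_Icc] at hb
  rw [(hd b).deriv]
  exact mul_pos hb.1 (exp_pos b)

theorem frontPosition_mem {b : ℝ} (hb : b ∈ Icc (0 : ℝ) 1) : frontPosition b ∈ Icc (0 : ℝ) 1 := by
  have h0 : frontPosition 0 = 0 := by simp [frontPosition]
  have h1 : frontPosition 1 = 1 := by simp [frontPosition]
  have hmono := frontPosition_strictMonoOn.monotoneOn
  constructor
  · rw [← h0]; exact hmono ⟨le_rfl, zero_le_one⟩ hb hb.1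
  · rw [← h1]; exact hmono hb ⟨zero_le_one, le_rfl⟩ hb.2

/-- The minimum in `limitPosition` switches at the front: a card reinserted ahead of it has, in the
limit, no untouched cards to its left. -/
theorem le_frontPosition_iff {b u : ℝ} : u ≤ frontPosition b ↔ 1 - b ≤ (1 - u) * exp (-b) := by
  have h : (1 - b) * exp b * exp (-b) = 1 - b := by rw [mul_assoc, ← exp_add]; simp
  rw [frontPosition, le_sub_comm, ← mul_le_mul_iff_left₀ (exp_pos (-b)), h]

theorem integral_limitPosition {b : ℝ} (hb : b ∈ Icc (0 : ℝ) 1) :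
    ∫ u in (0 : ℝ)..1, limitPosition b u = exp (1 - b) / 2 + exp 1 * b - exp b := by
  have hm := frontPosition_mem hb
  have hc : Continuous fun u : ℝ => exp (min ((1 - u) * exp (-b)) (1 - b)) := by fun_prop
  have hl : Continuous fun u : ℝ => (1 - u) * exp (1 - b) := by fun_prop
  have h1 : ∫ u in (0 : ℝ)..1, (1 - u) * exp (1 - b) = exp (1 - b) / 2 := by
    rw [intervalIntegral.integral_mul_const, intervalIntegral.integral_sub (by simp) (by simp)]
    simp
    ring
  have h2 : ∫ u in (0 : ℝ)..frontPosition b, exp (min ((1 - u) * exp (-b)) (1 - b)) =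
      frontPosition b * exp (1 - b) := by
    rw [intervalIntegral.integral_congr (g := fun _ => exp (1 - b))]
    · simp
    · intro u hu
      rw [uIcc_of_le hm.1] at hu
      simp only [min_eq_right (le_frontPosition_iff.1 hu.2)]
  have h3 : ∫ u in frontPosition b..1, exp (min ((1 - u) * exp (-b)) (1 - b)) =
      exp 1 - exp b := by
    rw [intervalIntegral.integral_congr (g := fun u => exp ((1 - u) * exp (-b)))]
    · have hd : ∀ u ∈ uIcc (frontPosition b) 1,
          HasDerivAt (fun u => -(exp b * exp ((1 - u) * exp (-b)))) (exp ((1 - u) * exp (-b))) u := by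
        intro u _
        have := ((((hasDerivAt_id u).const_sub 1).mul_const (exp (-b))).exp.const_mul (exp b)).neg
        refine this.congr_deriv ?_
        have h : exp b * exp (-b) = 1 := by rw [← exp_add]; simp
        simp only [id]
        linear_combination exp ((1 - u) * exp (-b)) * h
      have hcc : Continuous fun u : ℝ => exp ((1 - u) * exp (-b)) := by fun_prop
      rw [intervalIntegral.integral_eq_sub_of_hasDerivAt hd (hcc.intervalIntegrable _ _)]
      have e1 : (1 - frontPosition b) * exp (-b) = 1 - b := by
        rw [frontPosition, sub_sub_cancel, mul_assoc, ← exp_add]; simp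
      have e2 : exp b * exp (1 - b) = exp 1 := by rw [← exp_add]; ring_nf
      rw [e1, e2]
      simp
      ring
    · intro u hu
      rw [uIcc_of_le hm.2] at hu
      have : (1 - u) * exp (-b) ≤ 1 - b := by
        have e1 : (1 - frontPosition b) * exp (-b) = 1 - b := by
          rw [frontPosition, sub_sub_cancel, mul_assoc, ← exp_add]; simp
        rw [← e1]
        have := hu.1
        gcongr
      simp only [min_eq_left this]
  unfold limitPosition
  rw [intervalIntegral.integral_sub (hc.intervalIntegrable _ _) (hl.intervalIntegrable _ _), h1,
    ← intervalIntegral.integral_add_adjacent_intervals (b := frontPosition b)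
      (hc.intervalIntegrable _ _) (hc.intervalIntegrable _ _), h2, h3, frontPosition]
  have h4 : exp b * exp (1 - b) = exp 1 := by rw [← exp_add]; ring_nf
  linear_combination (-(1 - b)) * h4

/-! ### Comparison of two cards on the same side of the critical value -/

/-- The reinsertion position of card `b₁` that matches the reinsertion position `v` of card `b₂`,
with `d = exp (b₁ - b₂)`, exactly so on one side of a threshold `c`. -/
noncomputable def matching (d c v : ℝ) : ℝ := d * v + (1 - d) * if v ≤ c then 0 else 1

theorem monotone_step (c : ℝ) : Monotone fun v : ℝ => if v ≤ c then (0 : ℝ) else 1 := by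
  intro x y hxy
  dsimp only
  split_ifs <;> linarith

theorem intervalIntegrable_matching (d c : ℝ) : IntervalIntegrable (matching d c) volume 0 1 :=
  ((continuous_const.mul continuous_id).intervalIntegrable 0 1).add
    ((monotone_step c).intervalIntegrable.const_mul (1 - d))

/-- The value is 1/2 + (1 - d)(1/2 - c), so for d < 1 it exceeds 1/2 exactly when c < 1/2. -/
theorem integral_matching {d c : ℝ} (hc : c ∈ Icc (0 : ℝ) 1) :
    ∫ v in (0 : ℝ)..1, matching d c v = d / 2 + (1 - d) * (1 - c) := by
  have h1 : ∫ v in (0 : ℝ)..c, (if v ≤ c then (0 : ℝ) else 1) = 0 := by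
    rw [intervalIntegral.integral_congr (g := fun _ => (0 : ℝ))]
    · simp
    · intro v hv
      rw [uIcc_of_le hc.1] at hv
      simp [hv.2]
  have h2 : ∫ v in c..1, (if v ≤ c then (0 : ℝ) else 1) = 1 - c := by
    rw [intervalIntegral.integral_of_le hc.2, setIntegral_congr_fun (g := fun _ => (1 : ℝ))
      measurableSet_Ioc (fun v hv => by simp [not_le.2 hv.1]),
      ← intervalIntegral.integral_of_le hc.2]
    simp
  have hlin : Continuous fun v : ℝ => d * v := by fun_prop
  unfold matching
  rw [intervalIntegral.integral_add (hlin.intervalIntegrable 0 1)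
      ((monotone_step c).intervalIntegrable.const_mul (1 - d)),
    intervalIntegral.integral_const_mul, intervalIntegral.integral_const_mul,
    ← intervalIntegral.integral_add_adjacent_intervals (b := c)
      (monotone_step c).intervalIntegrable (monotone_step c).intervalIntegrable, h1, h2]
  simp
  ring

theorem matching_mem {d c v : ℝ} (hd : d ∈ Icc (0 : ℝ) 1) (hv : v ∈ Icc (0 : ℝ) 1) :
    matching d c v ∈ Icc (0 : ℝ) 1 := by
  have h1 : 0 ≤ d * v := mul_nonneg hd.1 hv.1
  have h2 : d * v ≤ d := mul_le_of_le_one_right hd.1 hv.2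
  have := hd.2
  unfold matching
  split_ifs <;> constructor <;> linarith

theorem limitPosition_of_le {b u : ℝ} (h : u ≤ frontPosition b) :
    limitPosition b u = exp (1 - b) * u := by
  rw [limitPosition, min_eq_right (le_frontPosition_iff.1 h)]
  ring

theorem limitPosition_le (b u : ℝ) : limitPosition b u ≤ exp (1 - b) * u := by
  have := exp_le_exp.2 (min_le_right ((1 - u) * exp (-b)) (1 - b))
  rw [limitPosition]
  linarith

theorem exp_mul_matching_low {b₁ b₂ v : ℝ} :
    exp (1 - b₁) * (exp (b₁ - b₂) * v) = exp (1 - b₂) * v := by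
  rw [← mul_assoc, ← exp_add]; ring_nf

theorem one_sub_matching_high {b₁ b₂ v : ℝ} :
    (1 - (exp (b₁ - b₂) * v + (1 - exp (b₁ - b₂)) * 1)) * exp (-b₁) = (1 - v) * exp (-b₂) := by
  have : exp (-b₂) = exp (b₁ - b₂) * exp (-b₁) := by rw [← exp_add]; ring_nf
  rw [this]; ring

/-- With the jump at the front of `b₂`, the match is exact above the jump, where both exponents are
uncapped and w agrees; below it, the linear upper bound for `b₁` meets the exact linear value for
`b₂`. -/
theorem half_lt_probLeft {b₁ b₂ : ℝ} (hb₁ : b₁ ∈ Icc (0 : ℝ) 1) (hb₂ : b₂ ∈ Icc (0 : ℝ) 1)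
    (hlt : b₁ < b₂) (hm : frontPosition b₂ < 1 / 2)
    {f g : ℝ → ℝ≥0∞} (hf : IsLimitDensity b₁ f) (hg : IsLimitDensity b₂ g) :
    1 / 2 < probLeft f g := by
  have hd1 : exp (b₁ - b₂) < 1 := (exp_lt_exp.2 (by linarith : b₁ - b₂ < 0)).trans_eq exp_zero
  have h := integral_le_probLeft hb₁ hb₂ hf hg
    (intervalIntegrable_matching (exp (b₁ - b₂)) (frontPosition b₂))
    (fun v hv => matching_mem ⟨(exp_pos _).le, hd1.le⟩ hv) ?_
  · rw [integral_matching (frontPosition_mem hb₂)] at h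
    nlinarith
  · intro v _
    unfold matching
    split_ifs with hv
    · rw [limitPosition_of_le hv, mul_zero, add_zero]
      exact (limitPosition_le _ _).trans_eq exp_mul_matching_low
    · have hw : (1 - v) * exp (-b₂) ≤ 1 - b₂ :=
        le_of_not_ge fun h => hv (le_frontPosition_iff.2 h)
      rw [limitPosition_eq, limitPosition_eq, one_sub_matching_high, min_eq_left hw,
        min_eq_left (by linarith)]

/-- With the jump at the front of `b₁`, the roles below the jump are exchanged; above it w agrees
and the cap 1 - b₂ is the smaller one. -/
theorem probLeft_lt_half {b₁ b₂ : ℝ} (hb₁ : b₁ ∈ Icc (0 : ℝ) 1) (hb₂ : b₂ ∈ Icc (0 : ℝ) 1)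
    (hlt : b₁ < b₂) (hm : 1 / 2 < frontPosition b₁)
    {f g : ℝ → ℝ≥0∞} (hf : IsLimitDensity b₁ f) (hg : IsLimitDensity b₂ g) :
    probLeft f g < 1 / 2 := by
  have hd1 : exp (b₁ - b₂) < 1 := (exp_lt_exp.2 (by linarith : b₁ - b₂ < 0)).trans_eq exp_zero
  have h := probLeft_le_integral hb₁ hb₂ hf hg
    (intervalIntegrable_matching (exp (b₁ - b₂)) (frontPosition b₁))
    (fun v hv => matching_mem ⟨(exp_pos _).le, hd1.le⟩ hv) ?_
  · rw [integral_matching (frontPosition_mem hb₁)] at h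
    nlinarith
  · intro v hv0
    unfold matching
    split_ifs with hv
    · have hle : exp (b₁ - b₂) * v ≤ frontPosition b₁ :=
        (mul_le_of_le_one_left hv0.1 hd1.le).trans hv
      rw [mul_zero, add_zero, limitPosition_of_le hle, exp_mul_matching_low]
      exact limitPosition_le _ _
    · rw [limitPosition_eq, limitPosition_eq, one_sub_matching_high]
      have : min ((1 - v) * exp (-b₂)) (1 - b₂) ≤ min ((1 - v) * exp (-b₂)) (1 - b₁) :=
        min_le_min_left _ (by linarith)
      gcongr

/-! ### Shape of the mean and numerical bounds -/

/-- The limiting rescaled mean position of a card with a number around `b` times the size of the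
deck. -/
noncomputable def limitMean (b : ℝ) : ℝ := exp (1 - b) / 2 + exp 1 * b - exp b

theorem hasDerivAt_limitMean (b : ℝ) :
    HasDerivAt limitMean (-(exp b ^ 2 - exp 1 * exp b + exp 1 / 2) / exp b) b := by
  have := (((((hasDerivAt_id b).const_sub 1).exp.div_const 2).add
    ((hasDerivAt_id b).const_mul (exp 1))).sub (Real.hasDerivAt_exp b))
  refine this.congr_deriv ?_
  have h : exp (1 - b) = exp 1 / exp b := exp_sub 1 b
  have hb := exp_pos b
  simp only [id, h]
  field_simp
  ring

theorem limitMean_one : limitMean 1 = 1 / 2 := by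
  simp [limitMean]

/-- The sign of the derivative is opposite to that of a quadratic in exp b, negative at b = 0 and
positive at b = 1. -/
theorem exists_limitMean_turning_point :
    ∃ c ∈ Ioo (0 : ℝ) 1, StrictMonoOn limitMean (Icc 0 c) ∧ StrictAntiOn limitMean (Icc c 1) := by
  have he1 := exp_one_gt_d9
  have he2 := exp_one_lt_d9
  let q : ℝ → ℝ := fun b => exp b ^ 2 - exp 1 * exp b + exp 1 / 2
  have hq : ContinuousOn q (Icc 0 1) := by
    have : Continuous q := by fun_prop
    exact this.continuousOn
  obtain ⟨c, hc, hqc⟩ : ∃ c ∈ Ioo (0 : ℝ) 1, q c = 0 := by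
    refine intermediate_value_Ioo zero_le_one hq ⟨?_, ?_⟩
    · simp only [q, exp_zero]; linarith
    · simp only [q]; nlinarith
  have hcont : Continuous limitMean := by unfold limitMean; fun_prop
  have hc1 : 1 < exp c := one_lt_exp_iff.2 hc.1
  -- The roots of the quadratic sum to e, so this places the other root, e - exp c, below 1 = exp 0.
  have hsum : 0 < 1 + exp c - exp 1 := by
    have : (1 - exp c) * (1 + exp c - exp 1) < 0 := by
      simp only [q] at hqc
      nlinarith
    nlinarith
  refine ⟨c, hc, strictMonoOn_of_deriv_pos (convex_Icc 0 c) hcont.continuousOn fun b hb => ?_,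
    strictAntiOn_of_deriv_neg (convex_Icc c 1) hcont.continuousOn fun b hb => ?_⟩
  · rw [interior_Icc] at hb
    rw [(hasDerivAt_limitMean b).deriv]
    refine div_pos ?_ (exp_pos b)
    have h1 : 1 < exp b := one_lt_exp_iff.2 hb.1
    have h2 : exp b < exp c := exp_lt_exp.2 hb.2
    simp only [q] at hqc
    nlinarith [mul_pos (sub_pos.2 h2) (by linarith : 0 < exp b + exp c - exp 1)]
  · rw [interior_Icc] at hb
    rw [(hasDerivAt_limitMean b).deriv]
    refine div_neg_of_neg_of_pos ?_ (exp_pos b)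
    have h2 : exp c < exp b := exp_lt_exp.2 hb.1
    simp only [q] at hqc
    nlinarith [mul_pos (sub_pos.2 h2) (by linarith : 0 < exp b + exp c - exp 1)]

/-- The last coefficient is the remainder bound 9/(8! · 8) = 1/35840. -/
theorem exp_le_taylor {x : ℝ} (h0 : 0 ≤ x) (h1 : x ≤ 1) :
    exp x ≤ 1 + x + x ^ 2 / 2 + x ^ 3 / 6 + x ^ 4 / 24 + x ^ 5 / 120 + x ^ 6 / 720 +
      x ^ 7 / 5040 + x ^ 8 / 35840 := by
  have := Real.exp_bound' h0 h1 (n := 8) (by norm_num)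
  simp only [Finset.sum_range_succ, Finset.sum_range_zero, Nat.factorial] at this
  norm_num at this
  linarith

theorem taylor_le_exp {x : ℝ} (h0 : 0 ≤ x) :
    1 + x + x ^ 2 / 2 + x ^ 3 / 6 + x ^ 4 / 24 + x ^ 5 / 120 + x ^ 6 / 720 + x ^ 7 / 5040 ≤
      exp x := by
  have := Real.sum_le_exp_of_nonneg h0 8
  simp only [Finset.sum_range_succ, Finset.sum_range_zero, Nat.factorial] at this
  norm_num at this
  linarith

theorem limitMean_lower : limitMean 0.3795 < 1 / 2 := by
  have h1 := exp_le_taylor (x := 0.6205) (by norm_num) (by norm_num)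
  have h2 := taylor_le_exp (x := 0.3795) (by norm_num)
  have h3 := exp_one_lt_d9
  have e : (1 : ℝ) - 0.3795 = 0.6205 := by norm_num
  rw [limitMean, e]
  norm_num at *
  linarith

theorem limitMean_upper : 1 / 2 < limitMean 0.3805 := by
  have h1 := taylor_le_exp (x := 0.6195) (by norm_num)
  have h2 := exp_le_taylor (x := 0.3805) (by norm_num) (by norm_num)
  have h3 := exp_one_gt_d9
  have e : (1 : ℝ) - 0.3805 = 0.6195 := by norm_num
  rw [limitMean, e]
  norm_num at *
  linarith

theorem frontPosition_lower : frontPosition 0.7675 < 1 / 2 := by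
  have h2 := taylor_le_exp (x := 0.7675) (by norm_num)
  rw [frontPosition]
  norm_num at *
  linarith

theorem frontPosition_upper : 1 / 2 < frontPosition 0.7685 := by
  have h2 := exp_le_taylor (x := 0.7685) (by norm_num) (by norm_num)
  rw [frontPosition]
  norm_num at *
  linarith

/-- Past the turning point the mean decreases to its value 1/2 at b = 1, so it stays above 1/2 on
[c,1); any crossing lies on the increasing branch and is unique. -/
theorem exists_limitMean_crossing :
    ∃ t ∈ Ioo (0.3795 : ℝ) 0.3805, limitMean t = 1 / 2 ∧
      ∀ b ∈ Ico (0 : ℝ) 1, (limitMean b < 1 / 2 ↔ b < t) ∧ (1 / 2 < limitMean b ↔ t < b) := by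
  have hcont : Continuous limitMean := by unfold limitMean; fun_prop
  obtain ⟨t, ht, hte⟩ := intermediate_value_Ioo (by norm_num : (0.3795 : ℝ) ≤ 0.3805)
    hcont.continuousOn ⟨limitMean_lower, limitMean_upper⟩
  obtain ⟨c, hc, hmono, hanti⟩ := exists_limitMean_turning_point
  have ht0 : 0 < t := lt_trans (by norm_num) ht.1
  have ht1 : t < 1 := ht.2.trans (by norm_num)
  have habove : ∀ b, c ≤ b → b < 1 → 1 / 2 < limitMean b := by
    intro b hcb hb
    rw [← limitMean_one]
    exact hanti ⟨hcb, hb.le⟩ ⟨hc.2.le, le_rfl⟩ hb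
  have htc : t < c := by
    by_contra h
    exact (habove t (not_lt.1 h) ht1).ne' hte
  have hlt : ∀ b, 0 ≤ b → b < t → limitMean b < 1 / 2 := by
    intro b hb0 hb
    rw [← hte]
    exact hmono ⟨hb0, (hb.trans htc).le⟩ ⟨ht0.le, htc.le⟩ hb
  have hgt : ∀ b, t < b → b < 1 → 1 / 2 < limitMean b := by
    intro b hb hb1
    rcases le_total c b with h | h
    · exact habove b h hb1
    · rw [← hte]
      exact hmono ⟨ht0.le, htc.le⟩ ⟨ht0.le.trans hb.le, h⟩ hb
  refine ⟨t, ht, hte, fun b hb => ⟨⟨fun h => ?_, hlt b hb.1⟩, ⟨fun h => ?_, fun h => hgt b h hb.2⟩⟩⟩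
  · rcases lt_trichotomy b t with h' | rfl | h'
    · exact h'
    · linarith
    · linarith [hgt b h' hb.2]
  · rcases lt_trichotomy b t with h' | rfl | h'
    · linarith [hlt b hb.1 h']
    · linarith
    · exact h'

theorem corollary4 :
    (∀ b ∈ Icc (0 : ℝ) 1, (∃ f : ℝ → ℝ≥0∞, IsLimitDensity b f) ∧ ∃ m : ℝ, IsLimitMean b m) ∧
    ∀ (f : ℝ → ℝ → ℝ≥0∞) (E : ℝ → ℝ),
      (∀ b ∈ Icc (0 : ℝ) 1, IsLimitDensity b (f b)) →
      (∀ b ∈ Icc (0 : ℝ) 1, IsLimitMean b (E b)) →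
      (∃ bhat ∈ Ioo (0 : ℝ) 1,
        (∀ b ∈ Icc (0 : ℝ) 1, (1 - b) * exp b - 1 / 2 = 0 ↔ b = bhat) ∧
        |bhat - 0.768| < 0.0005 ∧
        (∀ b₁ : ℝ, 0 ≤ b₁ → b₁ < bhat → ∃ ε > 0, ∀ b₂ : ℝ, b₁ < b₂ → b₂ < bhat → b₂ < b₁ + ε →
          1 / 2 < probLeft (f b₁) (f b₂)) ∧
        (∀ b₁ : ℝ, bhat < b₁ → b₁ < 1 → ∃ ε > 0, ∀ b₂ : ℝ, b₁ < b₂ → b₂ ≤ 1 → b₂ < b₁ + ε →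
          probLeft (f b₁) (f b₂) < 1 / 2)) ∧
      (∃ btilde ∈ Ioo (0 : ℝ) 1,
        (∀ b ∈ Ico (0 : ℝ) 1, E b = 1 / 2 ↔ b = btilde) ∧
        |btilde - 0.380| < 0.0005 ∧
        (∀ b ∈ Ico (0 : ℝ) 1,
          (1 / 2 < probLeft (f b) (f 1) ↔ b < btilde) ∧
          (probLeft (f b) (f 1) < 1 / 2 ↔ btilde < b))) := by
  refine ⟨fun b hb => ⟨⟨_, isLimitDensity_rnDeriv hb⟩, ⟨_, tendsto_meanPosition hb⟩⟩, ?_⟩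
  intro f E hf hE
  constructor
  · have hcont : Continuous frontPosition := by unfold frontPosition; fun_prop
    obtain ⟨t, ht, hte⟩ := intermediate_value_Ioo (by norm_num : (0.7675 : ℝ) ≤ 0.7685)
      hcont.continuousOn ⟨frontPosition_lower, frontPosition_upper⟩
    have ht0 : 0 < t := lt_trans (by norm_num) ht.1
    have ht1 : t < 1 := ht.2.trans (by norm_num)
    have htmem : t ∈ Icc (0 : ℝ) 1 := ⟨ht0.le, ht1.le⟩
    refine ⟨t, ⟨ht0, ht1⟩, fun b hb => ?_, ?_, ?_, ?_⟩
    · rw [← frontPosition_strictMonoOn.injOn.eq_iff hb htmem, hte, frontPosition]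
      constructor <;> intro h <;> linarith
    · rw [abs_lt]
      constructor <;> linarith [ht.1, ht.2]
    -- The comparison holds for all pairs on one side of the root, so any ε serves, here and in the
    -- next case.
    · refine fun b₁ h0 _ => ⟨1, one_pos, fun b₂ hlt h₂ _ => ?_⟩
      have hb₁ : b₁ ∈ Icc (0 : ℝ) 1 := ⟨h0, by linarith⟩
      have hb₂ : b₂ ∈ Icc (0 : ℝ) 1 := ⟨by linarith, by linarith⟩
      exact half_lt_probLeft hb₁ hb₂ hlt (hte ▸ frontPosition_strictMonoOn hb₂ htmem h₂)
        (hf b₁ hb₁) (hf b₂ hb₂)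
    · refine fun b₁ h₁ h1 => ⟨1, one_pos, fun b₂ hlt h₂ _ => ?_⟩
      have hb₁ : b₁ ∈ Icc (0 : ℝ) 1 := ⟨by linarith, h1.le⟩
      have hb₂ : b₂ ∈ Icc (0 : ℝ) 1 := ⟨by linarith, h₂⟩
      exact probLeft_lt_half hb₁ hb₂ hlt (hte ▸ frontPosition_strictMonoOn htmem hb₁ h₁)
        (hf b₁ hb₁) (hf b₂ hb₂)
  · obtain ⟨t, ht, hte, hiff⟩ := exists_limitMean_crossing
    have hEb : ∀ b ∈ Icc (0 : ℝ) 1, E b = limitMean b := fun b hb => by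
      rw [(hE b hb).eq_integral hb, integral_limitPosition hb, limitMean]
    refine ⟨t, ⟨lt_trans (by norm_num) ht.1, ht.2.trans (by norm_num)⟩, fun b hb => ?_, ?_,
      fun b hb => ?_⟩
    · rw [hEb b (Ico_subset_Icc_self hb)]
      constructor
      · intro h
        rcases lt_trichotomy b t with h' | h' | h'
        · exact absurd ((hiff b hb).1.2 h') h.not_lt
        · exact h'
        · exact absurd ((hiff b hb).2.2 h') h.not_gt
      · rintro rfl
        exact hte
    · rw [abs_lt]
      constructor <;> linarith [ht.1, ht.2]
    · have hb' := Ico_subset_Icc_self hb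
      have hprob : probLeft (f b) (f 1) = 1 - limitMean b := by
        rw [probLeft_one_eq hb' (hf b hb') (hf 1 ⟨zero_le_one, le_rfl⟩),
          integral_limitPosition hb', limitMean]
      rw [hprob, ← (hiff b hb).1, ← (hiff b hb).2]
      constructor <;> constructor <;> intro h <;> linarith
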